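/- Let $\mathbf{k}$ be a field of characteristic $0$. For a finite poset $(\mathcal{P},\preceq)$ let $\mathfrak{g}(\mathcal{P})$ be the Lie algebra spanned by the matrix units $E_{p,q}$ with $p\preceq q$, under the commutator bracket, and let $\mathfrak{g}_A(\mathcal{P})$ be the Lie subalgebra of its trace-zero elements. Let $E^*_{p,q}$ be the functional sending $B=\sum b_{p,q}E_{p,q}$ to $b_{p,q}$. For a functional $F$ on a finite-dimensional Lie algebra $\mathfrak{g}$ let $\ker(F)=\{B\in\mathfrak g : F([x,B])=0 \text{ for all } x\in\mathfrak g\}$ (the kernel of the Kirillov form). The index of $\mathfrak{g}$ is $\min_F\dim\ker(F)$; $\mathfrak{g}$ is Frobenius if its index is $0$, and $F$ is Frobenius if $\ker(F)=0$; the principal element $\widehat F$ of a Frobenius functional $F$ is defined by $F([\widehat F,x])=F(x)$ for all $x$. A Frobenius Lie algebra has a binary spectrum if the eigenvalues of $\mathrm{ad}(\widehat F)$, counted with multiplicity, are an equal number of $0$'s and $1$'s, the same for every Frobenius functional $F$. For a set $S$ of pairs $(p,q)$ with $p\prec q$, let $F=F_S=\sum_{(p,q)\in S}E^*_{p,q}$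 and let $\Gamma_F$ be the directed graph on $\mathcal{P}$ with edge set $S$. Let $Ext(\mathcal{P})$ be the set of minimal and maximal elements of $\mathcal{P}$, and $\Sigma(\mathcal{P})$ the order complex of $\mathcal{P}$ (simplices are the nonempty chains). The pair $(\mathcal{P},F)$ is a toral-pair if $\mathfrak{g}_A(\mathcal{P})$ is Frobenius, $F$ is a Frobenius functional on it, and - (P1) $|Ext(\mathcal{P})|\in\{2,3\}$; (P2) $\mathfrak{g}_A(\mathcal{P})$ has a binary spectrum; (P3) $\Sigma(\mathcal{P})$ is contractible; - (F1) $F$ is small: $\Gamma_F$ is a spanning subtree of the comparability graph of $\mathcal{P}$; (F2) the sinks of $\Gamma_F$ form a filter of $\mathcal{P}$, its sources form an order ideal, and every vertex is a sink or a source; (F3) $\Gamma_F$ contains all pairs $p\prec q$ with $p,q\in Ext(\mathcal{P})$; (F4) every $B\in\ker(F)$, the kernel being taken in $\mathfrak{g}(\mathcal{P})$, satisfies $E^*_{p,p}(B)=E^*_{q,q}(B)$ for all $p,q$ and $E^*_{p,q}(B)=0$ for all $p\prec q$. **Theorem.** Each of the following pairs $(\mathcal{P},F_{\mathcal{P}})$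 is a toral-pair (the order is the one generated by the listed relations): 1. $\mathcal{P}_3=\{p_1,\dots,p_6\}$ with $p_1\preceq p_2\preceq p_3,p_4$; $p_3\preceq p_5$; $p_4\preceq p_6$, and $F=E^*_{p_1,p_5}+E^*_{p_1,p_6}+E^*_{p_2,p_3}+E^*_{p_2,p_4}+E^*_{p_2,p_6}$. 2. $\mathcal{P}_3^*=\{p_1,\dots,p_6\}$ with $p_1\preceq p_3$; $p_2\preceq p_4$; $p_3,p_4\preceq p_5\preceq p_6$, and $F=E^*_{p_1,p_6}+E^*_{p_2,p_6}+E^*_{p_3,p_5}+E^*_{p_4,p_5}+E^*_{p_2,p_5}$. 3. For $n\ge 2$, $\mathcal{P}_{4,n}=\{p_1,\dots,p_n\}$ with $p_1\preceq\cdots\preceq p_{n-1}$ and $p_1\preceq\cdots\preceq p_{\lfloor n/2\rfloor}\preceq p_n$, and $F=\sum_{i=1}^{\lfloor (n-1)/2\rfloor}E^*_{p_i,p_{n-i}}+\sum_{i=1}^{\lfloor n/2\rfloor}E^*_{p_i,p_n}$. 4. For $n\ge 2$, $\mathcal{P}_{4,n}^*=\{p_1,\dots,p_n\}$ with $p_1\preceq\cdots\preceq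 p_{\lfloor (n-1)/2\rfloor}\preceq p_{\lfloor (n-1)/2\rfloor+2}\preceq\cdots\preceq p_n$ and $p_{\lfloor (n-1)/2\rfloor+1}\preceq p_{\lfloor (n-1)/2\rfloor+2}\preceq\cdots\preceq p_n$, and $F=\sum_{i=1}^{\lfloor (n-1)/2\rfloor}E^*_{p_i,p_{n+1-i}}+\sum_{i=\lceil n/2\rceil+1}^{n}E^*_{p_{\lceil n/2\rceil},p_i}$. 5. For $n\ge 1$, $\mathcal{P}_{5,n}=\{p_1,\dots,p_{2n+1}\}$ with $p_i\preceq p_j$ for $1\le i<2n$ odd and $i+1\le j\le 2n+1$, and for $1<i<2n$ even and $i+2\le j\le 2n+1$, and $F=E^*_{p_1,p_{2n+1}}+\sum_{i=1}^{2\lceil (n-1)/2\rceil+1}E^*_{p_i,p_{2n}}+\sum_{k=1}^{\lfloor (n-1)/2\rfloor}E^*_{p_{2k},p_{2n-2k}}+\sum_{k=1}^{\lfloor (n-1)/2\rfloor}E^*_{p_{2k+1},p_{2n-2k+1}}$. 6. For $n\ge 1$, $\mathcal{P}_{5,n}^*=\{p_1,\dots,p_{2n+1}\}$ with $p_i\preceq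 p_j$ for $1\le i<2n$ odd and $i+2\le j\le 2n+1$, and for $1<i\le 2n$ even and $i+1\le j\le 2n+1$, and $F=E^*_{p_1,p_{2n+1}}+\sum_{i=2\lfloor (n+1)/2\rfloor+1}^{2n+1}E^*_{p_2,p_i}+\sum_{k=2}^{\lfloor (n+1)/2\rfloor}E^*_{p_{2k},p_{2n-2k+4}}+\sum_{k=1}^{\lfloor (n-1)/2\rfloor}E^*_{p_{2k+1},p_{2n-2k+1}}$. -/

import Mathlib

attribute [local instance 100] LieRing.ofAssociativeRing

/-! ### Frobenius Lie algebras, principal elements, spectrum -/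

section LieAlgebras

variable (k : Type*) [Field k] {L : Type*} [LieRing L] [LieAlgebra k L]

/-- The Kirillov form `B_F(x, y) = F([x, y])` of a functional `F`. -/
noncomputable def kirillovForm (F : Module.Dual k L) : L →ₗ[k] Module.Dual k L :=
  LinearMap.mk₂ k (fun x y => F ⁅x, y⁆)
    (fun x y z => by simp) (fun c x y => by simp) (fun x y z => by simp) (fun c x y => by simp)

/-- The index of a Lie algebra: the minimum of `dim ker B_F` over all functionals `F`. -/
noncomputable def lieIndex (L : Type*) [LieRing L] [LieAlgebra k L] : ℕ :=
  sInf (Set.range fun F : Module.Dual k L => Module.finrank k (LinearMap.ker (kirillovForm k F)))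

/-- A finite-dimensional Lie algebra is Frobenius if its index is zero. -/
def IsFrobeniusLie (L : Type*) [LieRing L] [LieAlgebra k L] : Prop :=
  Module.Finite k L ∧ lieIndex k L = 0

/-- A functional is Frobenius if its Kirillov form is nondegenerate. -/
def IsFrobeniusFunctional (F : Module.Dual k L) : Prop :=
  LinearMap.ker (kirillovForm k F) = ⊥

/-- `x` is the principal element of `F`: `B_F(x, -) = F`. -/
def IsPrincipalElement (F : Module.Dual k L) (x : L) : Prop :=
  kirillovForm k F x = F

/-- The eigenvalues of `ad x = [x, -]` (in an algebraic closure), with algebraic multiplicity. -/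
noncomputable def adEigenvalues [Module.Finite k L] (x : L) : Multiset (AlgebraicClosure k) :=
  (LieAlgebra.ad k L x).charpoly.aroots (AlgebraicClosure k)

/-- A Frobenius Lie algebra has binary spectrum if the spectrum of `ad` of its principal elements,
whatever the Frobenius functional they come from, consists of equally many 0's and 1's. -/
def HasBinarySpectrum (L : Type*) [LieRing L] [LieAlgebra k L] [Module.Finite k L] : Prop :=
  IsFrobeniusLie k L ∧ ∃ m : ℕ, ∀ F : Module.Dual k L, IsFrobeniusFunctional k F →
    ∀ x : L, IsPrincipalElement k F x →
      adEigenvalues k x = Multiset.replicate m 0 + Multiset.replicate m 1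

end LieAlgebras

/-! ### Lie poset algebras -/

section PosetAlgebras

variable (k : Type*) [Field k] (P : Type*) [Fintype P] [DecidableEq P] [PartialOrder P]

/-- The Lie poset algebra `𝔤(P)`, with commutator bracket: the span of the matrix units `E_{p,q}`
with `p ≤ q`, i.e. the matrices indexed by `P` whose `(p, q)` entry vanishes unless `p ≤ q`. -/
def lieGL : LieSubalgebra k (Matrix P P k) where
  carrier := {B | ∀ p q, ¬ p ≤ q → B p q = 0}
  zero_mem' := fun _ _ _ => rfl
  add_mem' := by
    intro A B hA hB p q h
    simp [hA p q h, hB p q h]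
  smul_mem' := by
    intro c A hA p q h
    simp [hA p q h]
  lie_mem' := by
    intro A B hA hB p q h
    have key : ∀ X Y : Matrix P P k, (∀ p q, ¬ p ≤ q → X p q = 0) →
        (∀ p q, ¬ p ≤ q → Y p q = 0) → (X * Y) p q = 0 := by
      intro X Y hX hY
      rw [Matrix.mul_apply]
      refine Finset.sum_eq_zero fun r _ => ?_
      by_cases h1 : p ≤ r
      · rw [hY r q fun h2 => h (h1.trans h2), mul_zero]
      · rw [hX p r h1, zero_mul]
    simp [Ring.lie_def, key A B hA hB, key B A hB hA]

/-- The type-A Lie poset algebra `𝔤_A(P)`: the trace-zero elements of `𝔤(P)`. -/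
def lieA : LieSubalgebra k (Matrix P P k) where
  carrier := {B | B ∈ lieGL k P ∧ B.trace = 0}
  zero_mem' := ⟨(lieGL k P).zero_mem, by simp⟩
  add_mem' := by
    rintro A B ⟨hA, hA'⟩ ⟨hB, hB'⟩
    exact ⟨(lieGL k P).add_mem hA hB, by simp [hA', hB']⟩
  smul_mem' := by
    rintro c A ⟨hA, hA'⟩
    exact ⟨(lieGL k P).smul_mem c hA, by simp [hA']⟩
  lie_mem' := by
    rintro A B ⟨hA, _⟩ ⟨hB, _⟩
    exact ⟨(lieGL k P).lie_mem hA hB, by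
      rw [Ring.lie_def, Matrix.trace_sub, Matrix.trace_mul_comm, sub_self]⟩

variable {P}

/-- `∑_{(p,q) ∈ S} E*_{p,q}` as a functional on all matrices; `E*_{p,q}(B)` is the `(p, q)` entry
of `B`. -/
noncomputable def sumEntries (S : Finset (P × P)) : Module.Dual k (Matrix P P k) :=
  ∑ s ∈ S, Matrix.entryLinearMap k k s.1 s.2

/-- The functional `F_S = ∑_{(p,q) ∈ S} E*_{p,q}` on `𝔤(P)`. -/
noncomputable def functionalGL (S : Finset (P × P)) : Module.Dual k (lieGL k P) :=
  (sumEntries k S).comp (lieGL k P).toSubmodule.subtype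

/-- The functional `F_S = ∑_{(p,q) ∈ S} E*_{p,q}` on `𝔤_A(P)`. -/
noncomputable def functionalA (S : Finset (P × P)) : Module.Dual k (lieA k P) :=
  (sumEntries k S).comp (lieA k P).toSubmodule.subtype

end PosetAlgebras

/-! ### Combinatorics and topology of a finite poset -/

section Posets

variable (P : Type*) [Fintype P] [PartialOrder P]

/-- `Ext(P)`: the minimal and the maximal elements. -/
def extremalElements : Set P := {p | IsMin p ∨ IsMax p}

/-- The geometric realization of the order complex `Σ(P)`, whose simplices are the nonempty chains
of `P`: convex combinations of the elements of `P` that are supported on a chain. -/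
def orderComplexRealization : Set (P → ℝ) :=
  {w | w ∈ stdSimplex ℝ P ∧ IsChain (· ≤ ·) {p | w p ≠ 0}}

variable {P}

/-- Sinks of the directed graph `Γ` on `P` with edge set `S`. -/
def sinks (S : Finset (P × P)) : Set P := {p | ∀ q, (p, q) ∉ S}

/-- Sources of the directed graph `Γ` on `P` with edge set `S`. -/
def sources (S : Finset (P × P)) : Set P := {p | ∀ q, (q, p) ∉ S}

/-- `F_S` is small: `S` consists of strict relations of `P`, and the graph on all of `P` with edge
set `S` is a tree (a spanning subtree of the comparability graph). -/
def IsSmall (S : Finset (P × P)) : Prop :=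
  (∀ s ∈ S, s.1 < s.2) ∧ (SimpleGraph.fromRel fun p q => (p, q) ∈ S).IsTree

end Posets

/-- `(P, F_S)` is a toral-pair over the field `k`. -/
structure IsToralPair (k : Type*) [Field k] {P : Type*} [Fintype P] [DecidableEq P] [PartialOrder P]
    (S : Finset (P × P)) : Prop where
  frobenius : IsFrobeniusLie k (lieA k P)
  frobenius_functional : IsFrobeniusFunctional k (functionalA k S)
  /-- (P1) -/
  card_ext : (extremalElements P).ncard = 2 ∨ (extremalElements P).ncard = 3
  /-- (P2) -/
  binary : HasBinarySpectrum k (lieA k P)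
  /-- (P3) -/
  contractible : ContractibleSpace (orderComplexRealization P)
  /-- (F1) -/
  small : IsSmall S
  /-- (F2): the sinks form a filter, the sources an ideal, -/
  filter : IsUpperSet (sinks S)
  ideal : IsLowerSet (sources S)
  /-- and every vertex is a sink or a source. -/
  sink_or_source : ∀ p, p ∈ sinks S ∨ p ∈ sources S
  /-- (F3) -/
  ext_edges : ∀ p ∈ extremalElements P, ∀ q ∈ extremalElements P, p < q → (p, q) ∈ S
  /-- (F4): elements of the kernel of the Kirillov form of `F_S` on `𝔤(P)` are scalar. -/
  kernel : ∀ B ∈ LinearMap.ker (kirillovForm k (functionalGL k S)),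
    (∀ p q : P, B.1 p p = B.1 q q) ∧ ∀ p q : P, p < q → B.1 p q = 0

/-! ### The posets and functionals

The element `p_i` is the index `i`, `1 ≤ i ≤ m`; `⌊a/2⌋` is `a / 2` and `⌈a/2⌉` is `(a + 1) / 2`. -/

/-- The set `{1, …, m}`. The posets below are copies of it, each with its own partial order. -/
abbrev Label (m : ℕ) : Type := {i : ℕ // 1 ≤ i ∧ i ≤ m}

instance (m : ℕ) : Fintype (Label m) :=
  Fintype.subtype (Finset.Icc 1 m) (by simp)

/-- The pairs `(p_i, p_j)` with `(i, j) ∈ T`. -/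
def pairsOf {m : ℕ} (T : Finset (ℕ × ℕ)) : Finset (Label m × Label m) :=
  Finset.univ.filter fun s => (s.1.1, s.2.1) ∈ T

/-- `p₁ ≤ p₂ ≤ p₃, p₄`; `p₃ ≤ p₅`; `p₄ ≤ p₆`. -/
def P3 : Type := Label 6
instance : Fintype P3 := inferInstanceAs (Fintype (Label 6))
instance : DecidableEq P3 := inferInstanceAs (DecidableEq (Label 6))
instance : PartialOrder P3 where
  le a b := a.1 = b.1 ∨ (a.1 < b.1 ∧ (a.1 ≤ 2 ∨ b.1 = a.1 + 2))
  le_refl a := Or.inl rfl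
  le_trans a b c := by
    have := a.2; have := b.2; have := c.2; lia
  le_antisymm a b h1 h2 := Subtype.ext (by lia)

/-- `E*_{1,5} + E*_{1,6} + E*_{2,3} + E*_{2,4} + E*_{2,6}` -/
def S3 : Finset (P3 × P3) :=
  pairsOf (m := 6) {(1, 5), (1, 6), (2, 3), (2, 4), (2, 6)}

/-- `p₁ ≤ p₃`; `p₂ ≤ p₄`; `p₃, p₄ ≤ p₅ ≤ p₆`. -/
def P3Star : Type := Label 6
instance : Fintype P3Star := inferInstanceAs (Fintype (Label 6))
instance : DecidableEq P3Star := inferInstanceAs (DecidableEq (Label 6))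
instance : PartialOrder P3Star where
  le a b := a.1 = b.1 ∨ (a.1 < b.1 ∧ (5 ≤ b.1 ∨ b.1 = a.1 + 2))
  le_refl a := Or.inl rfl
  le_trans a b c := by
    have := a.2; have := b.2; have := c.2; lia
  le_antisymm a b h1 h2 := Subtype.ext (by lia)

/-- `E*_{1,6} + E*_{2,6} + E*_{3,5} + E*_{4,5} + E*_{2,5}` -/
def S3Star : Finset (P3Star × P3Star) :=
  pairsOf (m := 6) {(1, 6), (2, 6), (3, 5), (4, 5), (2, 5)}

/-- The chain `p₁ ≤ ⋯ ≤ p_{n-1}` together with `p₁ ≤ ⋯ ≤ p_{⌊n/2⌋} ≤ p_n`. -/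
def P4 (n : ℕ) : Type := Label n
instance (n : ℕ) : Fintype (P4 n) := inferInstanceAs (Fintype (Label n))
instance (n : ℕ) : DecidableEq (P4 n) := inferInstanceAs (DecidableEq (Label n))
instance (n : ℕ) : PartialOrder (P4 n) where
  le a b := a.1 = b.1 ∨ (a.1 < b.1 ∧ (b.1 ≤ n - 1 ∨ a.1 ≤ n / 2))
  le_refl a := Or.inl rfl
  le_trans a b c := by
    have := a.2; have := b.2; have := c.2; lia
  le_antisymm a b h1 h2 := Subtype.ext (by lia)

/-- `∑_{i=1}^{⌊(n-1)/2⌋} E*_{i,n-i} + ∑_{i=1}^{⌊n/2⌋} E*_{i,n}` -/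
def S4 (n : ℕ) : Finset (P4 n × P4 n) :=
  pairsOf (m := n) (
    (Finset.Icc 1 ((n - 1) / 2)).image (fun i => (i, n - i)) ∪
    (Finset.Icc 1 (n / 2)).image (fun i => (i, n)))

/-- The chain of all `p_i` with `i ≠ ⌊(n-1)/2⌋ + 1`, in the order of the indices, together with the
chain `p_{⌊(n-1)/2⌋+1} ≤ p_{⌊(n-1)/2⌋+2} ≤ ⋯ ≤ p_n`. -/
def P4Star (n : ℕ) : Type := Label n
instance (n : ℕ) : Fintype (P4Star n) := inferInstanceAs (Fintype (Label n))
instance (n : ℕ) : DecidableEq (P4Star n) := inferInstanceAs (DecidableEq (Label n))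
instance (n : ℕ) : PartialOrder (P4Star n) where
  le a b := a.1 = b.1 ∨ (a.1 < b.1 ∧ b.1 ≠ (n - 1) / 2 + 1)
  le_refl a := Or.inl rfl
  le_trans a b c := by
    have := a.2; have := b.2; have := c.2; lia
  le_antisymm a b h1 h2 := Subtype.ext (by lia)

/-- `∑_{i=1}^{⌊(n-1)/2⌋} E*_{i,n+1-i} + ∑_{i=⌈n/2⌉+1}^{n} E*_{⌈n/2⌉,i}` -/
def S4Star (n : ℕ) : Finset (P4Star n × P4Star n) :=
  pairsOf (m := n) (
    (Finset.Icc 1 ((n - 1) / 2)).image (fun i => (i, n + 1 - i)) ∪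
    (Finset.Icc ((n + 1) / 2 + 1) n).image (fun i => ((n + 1) / 2, i)))

/-- On `p₁, …, p_{2n+1}`: `p_i ≤ p_j` for `i` odd, `i + 1 ≤ j`, and for `i` even, `i + 2 ≤ j`. -/
def P5 (n : ℕ) : Type := Label (2 * n + 1)
instance (n : ℕ) : Fintype (P5 n) := inferInstanceAs (Fintype (Label (2 * n + 1)))
instance (n : ℕ) : DecidableEq (P5 n) := inferInstanceAs (DecidableEq (Label (2 * n + 1)))
instance (n : ℕ) : PartialOrder (P5 n) where
  le a b := a.1 = b.1 ∨ (a.1 % 2 = 1 ∧ a.1 + 1 ≤ b.1) ∨ (a.1 % 2 = 0 ∧ a.1 + 2 ≤ b.1)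
  le_refl a := Or.inl rfl
  le_trans a b c := by
    have := a.2; have := b.2; have := c.2; lia
  le_antisymm a b h1 h2 := Subtype.ext (by lia)

/-- `E*_{1,2n+1} + ∑_{i=1}^{2⌈(n-1)/2⌉+1} E*_{i,2n} + ∑_{k=1}^{⌊(n-1)/2⌋} E*_{2k,2n-2k}
+ ∑_{k=1}^{⌊(n-1)/2⌋} E*_{2k+1,2n-2k+1}`; note `⌈(n-1)/2⌉ = ⌊n/2⌋`. -/
def S5 (n : ℕ) : Finset (P5 n × P5 n) :=
  pairsOf (m := 2 * n + 1) (
    {(1, 2 * n + 1)} ∪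
    (Finset.Icc 1 (2 * (n / 2) + 1)).image (fun i => (i, 2 * n)) ∪
    (Finset.Icc 1 ((n - 1) / 2)).image (fun j => (2 * j, 2 * n - 2 * j)) ∪
    (Finset.Icc 1 ((n - 1) / 2)).image (fun j => (2 * j + 1, 2 * n - 2 * j + 1)))

/-- On `p₁, …, p_{2n+1}`: `p_i ≤ p_j` for `i` odd, `i + 2 ≤ j`, and for `i` even, `i + 1 ≤ j`. -/
def P5Star (n : ℕ) : Type := Label (2 * n + 1)
instance (n : ℕ) : Fintype (P5Star n) := inferInstanceAs (Fintype (Label (2 * n + 1)))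
instance (n : ℕ) : DecidableEq (P5Star n) := inferInstanceAs (DecidableEq (Label (2 * n + 1)))
instance (n : ℕ) : PartialOrder (P5Star n) where
  le a b := a.1 = b.1 ∨ (a.1 % 2 = 1 ∧ a.1 + 2 ≤ b.1) ∨ (a.1 % 2 = 0 ∧ a.1 + 1 ≤ b.1)
  le_refl a := Or.inl rfl
  le_trans a b c := by
    have := a.2; have := b.2; have := c.2; lia
  le_antisymm a b h1 h2 := Subtype.ext (by lia)

/-- `E*_{1,2n+1} + ∑_{i=2⌊(n+1)/2⌋+1}^{2n+1} E*_{2,i} + ∑_{k=2}^{⌊(n+1)/2⌋} E*_{2k,2n-2k+4}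
+ ∑_{k=1}^{⌊(n-1)/2⌋} E*_{2k+1,2n-2k+1}` -/
def S5Star (n : ℕ) : Finset (P5Star n × P5Star n) :=
  pairsOf (m := 2 * n + 1) (
    {(1, 2 * n + 1)} ∪
    (Finset.Icc (2 * ((n + 1) / 2) + 1) (2 * n + 1)).image (fun i => (2, i)) ∪
    (Finset.Icc 2 ((n + 1) / 2)).image (fun j => (2 * j, 2 * n - 2 * j + 4)) ∪
    (Finset.Icc 1 ((n - 1) / 2)).image (fun j => (2 * j + 1, 2 * n - 2 * j + 1)))

/-! The topological and graph-theoretic conditions are direct: each poset has a least or greatest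
element, so its order complex is a cone, and the graph is connected through a hub with one edge
fewer than vertices. Two points carry the proof.

Binary spectrum, for every Frobenius functional. Edges run from sources to sinks, so the indicator
of the sources, shifted to trace zero, is a principal element of `F_S`; as the sources form an
ideal, its weights on the relations are 0 or 1. Diagonal entries are characters of `𝔤_A(P)`, and a
character takes the same value on the principal elements of all Frobenius functionals
(`IsPrincipalElement.character_eq`): along a line `F + tG`, principal elements move by brackets. So
all principal elements share one diagonal, which alone determines the eigenvalues of `ad`, as `ad`
is triangular for a filtration. The trace of `ad`, half the dimension
(`IsPrincipalElement.two_mul_trace_ad`), makes 0 and 1 equally frequent.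

Scalar kernel. Testing against matrix units gives a linear system. For the families `S4` and `S5`,
it kills the source-sink block, and an order-reversing matching of sources with sinks other than the
hub identifies entries of the source block with entries of the sink block. Both blocks are
triangular but the matching reverses the order, so off-diagonal entries vanish; the hub then equates
the diagonal entries. `S3` is a finite system, and the starred cases follow by reversing the order.
In characteristic zero scalars split off, so the scalar kernel also makes `F_S` Frobenius on
`𝔤_A(P)`. -/

/-! ### Principal elements of Frobenius functionals and their spectrum. -/

open Polynomial in
/-- In characteristic zero, a polynomial whose Wronskian with `q` vanishes takes the same ratio with
`q` at any two points where `q` does not vanish. -/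
theorem eval_mul_eval_eq_of_derivative_mul_eq {k : Type*} [Field k] [CharZero k] {p q : k[X]}
    (h : derivative p * q = p * derivative q) {s : k} (hs : q.eval s ≠ 0) (t : k) :
    p.eval t * q.eval s = p.eval s * q.eval t := by
  set r : k[X] := p - C (p.eval s / q.eval s) * q with hr
  have hrs : r.IsRoot s := by
    simp [hr, IsRoot.def, hs]
  have hd : derivative r * q = r * derivative q := by
    rw [hr]
    simp only [derivative_sub, derivative_mul, derivative_C, zero_mul, zero_add]
    linear_combination h
  have hq0 : q ≠ 0 := by rintro rfl; simp at hs
  have hr0 : r = 0 := by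
    by_contra hne
    -- Differentiation lowers the multiplicity of `s` by exactly one, yet `r' q = r q'` with `q(s) ≠
    -- 0` would make the full power of `X - s` divide `r'`.
    have hm := derivative_rootMultiplicity_of_root hrs
    have hpos : 0 < r.rootMultiplicity s := (rootMultiplicity_pos hne).2 hrs
    have hdvd : (X - C s) ^ r.rootMultiplicity s ∣ derivative r * q := by
      rw [hd]
      exact (pow_rootMultiplicity_dvd r s).mul_right _
    have hcop : IsCoprime ((X - C s) ^ r.rootMultiplicity s) q := by
      refine IsCoprime.pow_left ?_
      refine (Irreducible.coprime_iff_not_dvd (irreducible_X_sub_C s)).2 ?_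
      rwa [dvd_iff_isRoot]
    have hdvd' := hcop.dvd_of_dvd_mul_right hdvd
    have hdr : derivative r ≠ 0 := by
      intro h0
      have := derivative_eq_zero.1 h0
      rw [eq_C_of_natDegree_eq_zero this] at hrs hne
      simp only [IsRoot.def, eval_C] at hrs
      simp [hrs] at hne
    have := (le_rootMultiplicity_iff hdr).2 hdvd'
    omega
  have := congrArg (eval t) hr0
  simp only [hr, eval_sub, eval_mul, eval_C, eval_zero] at this
  field_simp at this
  linear_combination this

section Frobenius

variable {k : Type*} [Field k] {L : Type*} [LieRing L] [LieAlgebra k L]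

theorem kirillovForm_apply (F : Module.Dual k L) (x y : L) : kirillovForm k F x y = F ⁅x, y⁆ := rfl

theorem IsFrobeniusFunctional.eq_zero {F : Module.Dual k L} (hF : IsFrobeniusFunctional k F) {x : L}
    (hx : ∀ y : L, F ⁅x, y⁆ = 0) : x = 0 :=
  LinearMap.ker_eq_bot'.1 hF x (LinearMap.ext hx)

theorem IsFrobeniusFunctional.exists_eq [Module.Finite k L] {F : Module.Dual k L}
    (hF : IsFrobeniusFunctional k F) (G : Module.Dual k L) :
    ∃ x : L, ∀ y : L, F ⁅x, y⁆ = G y := by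
  have hs : Function.Surjective (kirillovForm k F) :=
    (LinearMap.injective_iff_surjective_of_finrank_eq_finrank
      (Subspace.dual_finrank_eq (K := k) (V := L)).symm).1 (LinearMap.ker_eq_bot.1 hF)
  obtain ⟨x, hx⟩ := hs G
  exact ⟨x, fun y => congrArg (fun f => f y) hx⟩

/-- The infinitesimal form of the transitivity of the coadjoint action on Frobenius functionals:
along the line `F + tG`, a (rescaled) principal element moves by a multiple of a bracket. -/
theorem IsFrobeniusFunctional.mul_character_eq [Module.Finite k L] {F G : Module.Dual k L}
    (hF : IsFrobeniusFunctional k F) {χ : Module.Dual k L} (hχ : ∀ x y : L, χ ⁅x, y⁆ = 0) {a a' : L}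
    {c c' : k} (h : ∀ y : L, F ⁅a, y⁆ = c * F y)
    (h' : ∀ y : L, F ⁅a', y⁆ + G ⁅a, y⁆ = c' * F y + c * G y) : c * χ a' = c' * χ a := by
  obtain ⟨z, hz⟩ := hF.exists_eq G
  -- Writing `G` as `F ⁅z, ·⁆` and using Jacobi turns `h'` into `F ⁅⁅z, a⁆ + a', y⁆ = c' F y`; times
  -- `c`, the right side is `c' F ⁅a, y⁆`, and nondegeneracy removes `F`.
  have key : c • (⁅z, a⁆ + a') - c' • a = 0 := by
    refine hF.eq_zero fun y => ?_
    have h1 := h' y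
    rw [← hz, ← hz y, leibniz_lie, map_add, h ⁅z, y⁆] at h1
    have h2 := h y
    simp only [sub_lie, smul_lie, add_lie, map_sub, map_smul, map_add, smul_eq_mul]
    linear_combination c * h1 - c' * h2
  have := congrArg χ key
  simp only [map_sub, map_smul, map_add, smul_eq_mul, hχ, map_zero] at this
  linear_combination this

open Polynomial Matrix in
/-- Characters of a Lie algebra take the same value on the principal elements of all Frobenius
functionals. -/
theorem IsPrincipalElement.character_eq [CharZero k] [Module.Finite k L] {F F' : Module.Dual k L}
    (hF : IsFrobeniusFunctional k F) (hF' : IsFrobeniusFunctional k F') {x x' : L}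
    (hx : IsPrincipalElement k F x) (hx' : IsPrincipalElement k F' x') {χ : Module.Dual k L}
    (hχ : ∀ x y : L, χ ⁅x, y⁆ = 0) : χ x = χ x' := by
  classical
  let b := Module.finBasis k L
  let G := F' - F
  -- Cramer's rule over `k[X]` for the Kirillov form of `F + tG`: wherever `δ = det M` is nonzero,
  -- `a` is `δ` times the principal element.
  let M : Matrix (Fin (Module.finrank k L)) (Fin (Module.finrank k L)) k[X] :=
    Matrix.of fun i j => C (F ⁅b i, b j⁆) + X * C (G ⁅b i, b j⁆)
  let v : Fin (Module.finrank k L) → k[X] := fun j => C (F (b j)) + X * C (G (b j))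
  let δ : k[X] := M.det
  let a : Fin (Module.finrank k L) → k[X] := v ᵥ* M.adjugate
  have haM : ∀ j, ∑ i, a i * M i j = δ * v j := by
    intro j
    have : a ᵥ* M = δ • v := by
      simp only [a, δ, Matrix.vecMul_vecMul, Matrix.adjugate_mul, Matrix.vecMul_smul,
        Matrix.vecMul_one]
    exact congrFun this j
  have haM' : ∀ j, ∑ i, (derivative (a i) * M i j + a i * C (G ⁅b i, b j⁆)) =
      derivative δ * v j + δ * C (G (b j)) := by
    intro j
    have := congrArg derivative (haM j)
    simpa [M, v, derivative_mul, derivative_sum] using this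
  let Ft : k → Module.Dual k L := fun t => F + t • G
  let lift : (Fin (Module.finrank k L) → k[X]) → k → L := fun p t => ∑ i, (p i).eval t • b i
  have hMt : ∀ t i j, (M i j).eval t = Ft t ⁅b i, b j⁆ := by
    intro t i j; simp [M, Ft]; exact mul_comm _ _
  have hvt : ∀ t j, (v j).eval t = Ft t (b j) := by
    intro t j; simp [v, Ft]; exact mul_comm _ _
  have hlift : ∀ (H : Module.Dual k L) p t j,
      H ⁅lift p t, b j⁆ = ∑ i, (p i).eval t * H ⁅b i, b j⁆ := by
    intro H p t j
    rw [← kirillovForm_apply]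
    simp [lift, kirillovForm_apply]
  have hext : ∀ {f g : Module.Dual k L}, (∀ j, f (b j) = g (b j)) → ∀ y, f y = g y :=
    fun h y => congrArg (fun f => f y) (b.ext h)
  have h1 : ∀ t (y : L), Ft t ⁅lift a t, y⁆ = δ.eval t * Ft t y := by
    intro t
    refine hext (f := kirillovForm k (Ft t) (lift a t)) (g := δ.eval t • Ft t) fun j => ?_
    rw [kirillovForm_apply, hlift]
    have := congrArg (eval t) (haM j)
    simpa [eval_finsetSum, hMt, hvt] using this
  have h2 : ∀ t (y : L), Ft t ⁅lift (fun i => derivative (a i)) t, y⁆ + G ⁅lift a t, y⁆ =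
      (derivative δ).eval t * Ft t y + δ.eval t * G y := by
    intro t
    refine hext (f := kirillovForm k (Ft t) (lift (fun i => derivative (a i)) t) +
      kirillovForm k G (lift a t)) (g := (derivative δ).eval t • Ft t + δ.eval t • G) fun j => ?_
    rw [LinearMap.add_apply, kirillovForm_apply, kirillovForm_apply, hlift, hlift]
    have := congrArg (eval t) (haM' j)
    simpa only [eval_finsetSum, eval_add, eval_mul, hMt, hvt, eval_C, Finset.sum_add_distrib,
      LinearMap.add_apply, LinearMap.smul_apply, smul_eq_mul] using this
  have hdet : ∀ t, δ.eval t ≠ 0 ↔ IsFrobeniusFunctional k (Ft t) := by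
    intro t
    have hδ : δ.eval t = (Matrix.of fun i j => Ft t ⁅b i, b j⁆).det := by
      have := RingHom.map_det (evalRingHom t) M
      simp only [coe_evalRingHom] at this
      simp only [δ]
      rw [this]
      congr 1
      ext i j
      simp [hMt]
    rw [hδ, ← not_iff_not, not_not, ← Matrix.exists_vecMul_eq_zero_iff, IsFrobeniusFunctional,
      LinearMap.ker_eq_bot']
    push Not
    constructor
    · rintro ⟨w, hw, h0⟩
      refine ⟨∑ i, w i • b i, ?_, ?_⟩
      · refine b.ext fun j => ?_
        have := congrFun h0 j
        simpa [kirillovForm_apply, Matrix.vecMul, dotProduct] using this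
      · intro h
        refine hw (funext fun i => ?_)
        exact Fintype.linearIndependent_iff.1 b.linearIndependent w h i
    · rintro ⟨z, hz, hz0⟩
      refine ⟨fun i => b.repr z i, ?_, ?_⟩
      · intro h
        exact hz0 (b.repr.map_eq_zero_iff.1 (Finsupp.ext fun i => congrFun h i))
      · ext j
        have := congrArg (fun f => f (b j)) hz
        rw [← b.sum_repr z, map_sum] at this
        simpa only [map_smul, LinearMap.sum_apply, LinearMap.smul_apply, smul_eq_mul,
          kirillovForm_apply, Matrix.vecMul, dotProduct, Matrix.of_apply, Pi.zero_apply,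
          LinearMap.zero_apply] using this
  let α : k[X] := ∑ i, a i * C (χ (b i))
  have hα : ∀ t, α.eval t = χ (lift a t) := by
    intro t; simp [α, lift, eval_finsetSum]
  have hα' : ∀ t, (derivative α).eval t = χ (lift (fun i => derivative (a i)) t) := by
    intro t; simp [α, lift, eval_finsetSum]
  -- The quotient `α / δ` is `χ` of the principal element at `t`; this says that its derivative is
  -- zero.
  have hW : derivative α * δ = α * derivative δ := by
    have hF0 : Ft 0 = F := by simp [Ft]
    have hδ0 : δ ≠ 0 := by
      rintro h
      exact (hdet 0).2 (hF0 ▸ hF) (by simp [h])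
    -- The extra factor `δ` makes the identity trivial at the parameters where `F + tG` is not
    -- Frobenius.
    refine mul_right_cancel₀ hδ0 (Polynomial.funext fun t => ?_)
    by_cases ht : δ.eval t = 0
    · simp [ht]
    · have := ((hdet t).1 ht).mul_character_eq hχ (h1 t) (h2 t)
      rw [← hα, ← hα'] at this
      simp only [eval_mul]
      linear_combination δ.eval t * this
  have hprin : ∀ t (H : Module.Dual k L) (y : L), Ft t = H → IsFrobeniusFunctional k H →
      IsPrincipalElement k H y → δ.eval t ≠ 0 ∧ α.eval t = δ.eval t * χ y := by
    intro t H y hH hfr hy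
    refine ⟨(hdet t).2 (hH ▸ hfr), ?_⟩
    have : lift a t - δ.eval t • y = 0 := by
      refine hfr.eq_zero fun w => ?_
      have hyw : H ⁅y, w⁆ = H w := congrArg (fun f => f w) hy
      have := h1 t w
      rw [hH] at this
      simp [sub_lie, smul_lie, hyw, this]
    rw [hα, sub_eq_zero.1 this, map_smul, smul_eq_mul]
  obtain ⟨d0, e0⟩ := hprin 0 F x (by simp [Ft]) hF hx
  obtain ⟨d1, e1⟩ := hprin 1 F' x' (by simp [Ft, G]) hF' hx'
  have := eval_mul_eval_eq_of_derivative_mul_eq hW d0 1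
  rw [e0, e1] at this
  refine mul_left_cancel₀ (mul_ne_zero d0 d1) ?_
  linear_combination -this

/-- Half of the dimension of a Frobenius Lie algebra is the trace of `ad` of a principal element. -/
theorem IsPrincipalElement.two_mul_trace_ad [Module.Finite k L] {F : Module.Dual k L}
    (hF : IsFrobeniusFunctional k F) {x : L} (hx : IsPrincipalElement k F x) :
    2 * LinearMap.trace k L (LieAlgebra.ad k L x) = Module.finrank k L := by
  let Φ : L ≃ₗ[k] Module.Dual k L := LinearEquiv.ofInjectiveOfFinrankEq (kirillovForm k F)
    (LinearMap.ker_eq_bot.1 hF) (Subspace.dual_finrank_eq (K := k) (V := L)).symm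
  have hΦ : ∀ u w, Φ u w = F ⁅u, w⁆ := fun u w => rfl
  -- Since `F ⁅x, ⁅u, w⁆⁆ = F ⁅u, w⁆`, Jacobi shows that the Kirillov form conjugates `ad x` into
  -- the identity minus its transpose; then traces are compared.
  have hconj : Φ.conj (LieAlgebra.ad k L x) +
      Module.Dual.transpose (R := k) (LieAlgebra.ad k L x) = LinearMap.id := by
    refine LinearMap.ext fun f => ?_
    obtain ⟨u, rfl⟩ := Φ.surjective f
    refine LinearMap.ext fun w => ?_
    have h1 : F ⁅x, ⁅u, w⁆⁆ = F ⁅u, w⁆ := congrArg (fun f => f ⁅u, w⁆) hx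
    rw [leibniz_lie, map_add] at h1
    simp only [LinearEquiv.conj_apply_apply, LinearEquiv.symm_apply_apply, LinearMap.add_apply,
      LinearMap.id_apply, Module.Dual.transpose_apply, LinearMap.comp_apply, hΦ,
      LieAlgebra.ad_apply]
    linear_combination h1
  have h := congrArg (LinearMap.trace k _) hconj
  rw [map_add, LinearMap.trace_conj', LinearMap.trace_transpose', LinearMap.trace_id,
    Subspace.dual_finrank_eq] at h
  linear_combination h

open Polynomial in
/-- If `ad x (ad x - 1)` is nilpotent for a principal element `x`, then the spectrum of `ad x`
consists of equally many 0's and 1's. -/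
theorem IsPrincipalElement.adEigenvalues_eq [CharZero k] [Module.Finite k L] {F : Module.Dual k L}
    (hF : IsFrobeniusFunctional k F) {x : L} (hx : IsPrincipalElement k F x)
    (hnil : IsNilpotent (LieAlgebra.ad k L x * (LieAlgebra.ad k L x - 1))) :
    adEigenvalues k x = Multiset.replicate (Module.finrank k L / 2) 0 +
      Multiset.replicate (Module.finrank k L / 2) 1 := by
  classical
  set T : Module.End k L := LieAlgebra.ad k L x with hT
  let K := AlgebraicClosure k
  have : CharZero K := inferInstanceAs (CharZero (AlgebraicClosure k))
  let TK : Module.End K (TensorProduct k K L) := T.baseChange K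
  have hchar : TK.charpoly = T.charpoly.map (algebraMap k K) := LinearMap.charpoly_baseChange ..
  have hroots : adEigenvalues k x = TK.charpoly.roots := by
    rw [hchar]; rfl
  have hsplit : TK.charpoly.Splits := IsAlgClosed.splits _
  have hmem : ∀ μ ∈ TK.charpoly.roots, μ = 0 ∨ μ = 1 := by
    intro μ hμ
    have hev : TK.HasEigenvalue μ :=
      (Module.End.hasEigenvalue_iff_isRoot_charpoly TK μ).2 (isRoot_of_mem_roots hμ)
    obtain ⟨w, hw⟩ := hev.exists_hasEigenvector
    obtain ⟨N, hN⟩ := hnil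
    have h0 : (TK * (TK - 1)) ^ N = 0 := by
      have : TK * (TK - 1) = (T * (T - 1)).baseChange K := by
        simp only [TK, Module.End.mul_eq_comp, LinearMap.baseChange_comp, LinearMap.baseChange_sub]
        congr
        exact (LinearMap.baseChange_id).symm
      rw [this, ← LinearMap.baseChange_pow, hN, LinearMap.baseChange_zero]
    have h1 : aeval TK ((X * (X - 1)) ^ N : K[X]) = 0 := by
      simpa using h0
    have h2 := Module.End.aeval_apply_of_hasEigenvector (p := ((X * (X - 1)) ^ N : K[X])) hw
    rw [h1, LinearMap.zero_apply, eq_comm, smul_eq_zero, or_iff_left hw.2] at h2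
    have h3 : μ * (μ - 1) = 0 := by
      rw [eval_pow] at h2
      simpa using eq_zero_of_pow_eq_zero h2
    rcases mul_eq_zero.1 h3 with h | h
    · exact Or.inl h
    · exact Or.inr (sub_eq_zero.1 h)
  have hcount : ∀ s : Multiset K, (∀ μ ∈ s, μ = 0 ∨ μ = 1) →
      ∃ m n, s = Multiset.replicate m 0 + Multiset.replicate n 1 := by
    intro s
    induction s using Multiset.induction_on with
    | empty => exact fun _ => ⟨0, 0, rfl⟩
    | cons μ s ih =>
      intro h
      obtain ⟨m, n, hs⟩ := ih fun ν hν => h ν (Multiset.mem_cons_of_mem hν)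
      rcases h μ (Multiset.mem_cons_self _ _) with rfl | rfl
      · exact ⟨m + 1, n, by rw [hs, Multiset.replicate_succ, Multiset.cons_add]⟩
      · exact ⟨m, n + 1, by rw [hs, Multiset.replicate_succ, Multiset.add_cons]⟩
  obtain ⟨m, n, hmn⟩ := hcount _ hmem
  have hcard : m + n = Module.finrank k L := by
    have h1 := splits_iff_card_roots.1 hsplit
    rw [hmn, LinearMap.charpoly_natDegree, Module.finrank_baseChange] at h1
    simpa using h1
  -- The trace counts the roots equal to 1.
  have htr : (2 * n : K) = Module.finrank k L := by
    have h1 := Module.End.trace_eq_sum_roots_charpoly_of_splits hsplit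
    have h2 : LinearMap.trace K _ TK = algebraMap k K (LinearMap.trace k L T) :=
      LinearMap.trace_baseChange T K
    have h3 := congrArg (algebraMap k K) (hx.two_mul_trace_ad hF)
    rw [h2, hmn] at h1
    rw [map_mul, ← hT, h1, map_ofNat, map_natCast] at h3
    simpa using h3
  have htr' : 2 * n = Module.finrank k L :=
    Nat.cast_injective (R := K) (by rw [Nat.cast_mul, Nat.cast_ofNat, htr])
  have hm : m = Module.finrank k L / 2 := by omega
  have hn : n = Module.finrank k L / 2 := by omega
  rw [hroots, hmn, hm, hn]

theorem IsFrobeniusFunctional.isFrobeniusLie [Module.Finite k L] {F : Module.Dual k L}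
    (hF : IsFrobeniusFunctional k F) : IsFrobeniusLie k L := by
  refine ⟨inferInstance, Nat.sInf_eq_zero.2 (Or.inl ⟨F, ?_⟩)⟩
  have : LinearMap.ker (kirillovForm k F) = ⊥ := hF
  exact (congrArg (fun N : Submodule k L => Module.finrank k N) this).trans (finrank_bot k L)

end Frobenius

/-! ### Lie poset algebras: kernel equations and binary spectrum. -/

theorem sumEntries_apply {k : Type*} [Field k] {P : Type*} (S : Finset (P × P)) (B : Matrix P P k) :
    sumEntries k S B = ∑ s ∈ S, B s.1 s.2 := by
  simp [sumEntries, Matrix.entryLinearMap_apply]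

/-- Right multiplication by `E_{p,q}` moves column `p` to column `q`, left multiplication moves row
`q` to row `p`. Only edges ending at `q` or starting at `p` contribute. -/
theorem sumEntries_lie_single {k : Type*} [Field k] {P : Type*} [Fintype P] [DecidableEq P]
    (S : Finset (P × P)) (B : Matrix P P k) (p q : P) :
    sumEntries k S ⁅B, Matrix.single p q (1 : k)⁆ =
      ∑ s with (s, q) ∈ S, B s p - ∑ t with (p, t) ∈ S, B q t := by
  have hS : ∀ f : P × P → k, ∑ s ∈ S, f s = ∑ i, ∑ j, if (i, j) ∈ S then f (i, j) else 0 := by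
    intro f
    rw [← Fintype.sum_prod_type (f := fun s : P × P => if s ∈ S then f s else 0),
      ← Finset.sum_filter, Finset.filter_mem_eq_inter, Finset.univ_inter]
  rw [Ring.lie_def, map_sub, sumEntries_apply, sumEntries_apply, hS, hS]
  congr 1
  · rw [Finset.sum_filter]
    refine Finset.sum_congr rfl fun i _ => ?_
    rw [Finset.sum_eq_single q]
    · simp
    · intro j _ hj
      rw [Matrix.mul_single_apply_of_ne _ _ _ _ _ hj, ite_self]
    · simp
  · rw [Finset.sum_filter, Finset.sum_eq_single p]
    · simp
    · intro i _ hi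
      refine Finset.sum_eq_zero fun j _ => ?_
      rw [Matrix.single_mul_apply_of_ne _ _ _ _ _ hi, ite_self]
    · simp

section LiePosetAlgebras

variable {k : Type*} [Field k] {P : Type*} [Fintype P] [DecidableEq P] [PartialOrder P]

theorem functionalA_apply (S : Finset (P × P)) (B : lieA k P) :
    functionalA k S B = ∑ s ∈ S, B.1 s.1 s.2 := sumEntries_apply S B.1

theorem diagonal_mem_lieGL (d : P → k) : Matrix.diagonal d ∈ lieGL k P := by
  intro p q h
  exact Matrix.diagonal_apply_ne _ fun hpq => h hpq.le

theorem single_mem_lieGL {p q : P} (h : p ≤ q) : Matrix.single p q (1 : k) ∈ lieGL k P := by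
  intro i j hij
  refine Matrix.single_apply_of_ne _ _ _ _ _ ?_
  rintro ⟨rfl, rfl⟩
  exact hij h

variable (k) in
/-- The equations for the kernel of the Kirillov form of `F_S` on `𝔤(P)`, evaluated on the matrix
units, have only scalar solutions. -/
def HasScalarKernel (S : Finset (P × P)) : Prop :=
  ∀ b : P → P → k, (∀ p q, ¬ p ≤ q → b p q = 0) →
    (∀ p q, p ≤ q → ∑ s with (s, q) ∈ S, b s p = ∑ t with (p, t) ∈ S, b q t) →
    (∀ p q, b p p = b q q) ∧ ∀ p q, p < q → b p q = 0

theorem HasScalarKernel.of_lie_eq_zero {S : Finset (P × P)} (hS : HasScalarKernel k S)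
    {B : Matrix P P k} (hB : B ∈ lieGL k P) (h : ∀ X ∈ lieGL k P, sumEntries k S ⁅B, X⁆ = 0) :
    (∀ p q, B p p = B q q) ∧ ∀ p q, p < q → B p q = 0 := by
  refine hS B hB fun p q hpq => ?_
  have := h _ (single_mem_lieGL hpq)
  rwa [sumEntries_lie_single, sub_eq_zero] at this

/-- In characteristic zero `𝔤(P)` is `𝔤_A(P)` plus the central scalars, so a kernel element on
`𝔤_A(P)` is one on `𝔤(P)`, hence scalar; having trace zero, it vanishes. -/
theorem HasScalarKernel.isFrobeniusFunctional [CharZero k] [Nonempty P] {S : Finset (P × P)}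
    (hS : HasScalarKernel k S) : IsFrobeniusFunctional k (functionalA k S) := by
  refine LinearMap.ker_eq_bot'.2 fun B hB => ?_
  have hcard : (Fintype.card P : k) ≠ 0 := Nat.cast_ne_zero.2 Fintype.card_ne_zero
  obtain ⟨hd, ho⟩ := hS.of_lie_eq_zero B.2.1 fun X hX => by
    let c : k := X.trace / Fintype.card P
    have hX' : X - Matrix.diagonal (fun _ : P => c) ∈ lieA k P := by
      refine ⟨(lieGL k P).sub_mem hX (diagonal_mem_lieGL _), ?_⟩
      rw [Matrix.trace_sub, Matrix.trace_diagonal, Finset.sum_const, nsmul_eq_mul,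
        Finset.card_univ, mul_div_cancel₀ _ hcard, sub_self]
    have h0 : sumEntries k S ⁅B.1, X - Matrix.diagonal (fun _ : P => c)⁆ = 0 :=
      congrArg (fun f => f ⟨_, hX'⟩) hB
    have hc : ⁅B.1, Matrix.diagonal (fun _ : P => c)⁆ = 0 := by
      have : Matrix.diagonal (fun _ : P => c) = c • (1 : Matrix P P k) :=
        (Matrix.smul_one_eq_diagonal c).symm
      rw [Ring.lie_def, this, mul_smul_comm, smul_mul_assoc, mul_one, one_mul, sub_self]
    rwa [lie_sub, hc, sub_zero] at h0
  obtain ⟨p₀⟩ := ‹Nonempty P›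
  have htr := B.2.2
  have h0 : B.1 p₀ p₀ = 0 := by
    have : (Fintype.card P : k) * B.1 p₀ p₀ = 0 := by
      rw [← htr, Matrix.trace, ← Finset.card_univ, ← nsmul_eq_mul, ← Finset.sum_const]
      exact Finset.sum_congr rfl fun p _ => hd p₀ p
    exact (mul_eq_zero.1 this).resolve_left hcard
  refine Subtype.ext (Matrix.ext fun p q => ?_)
  by_cases hpq : p = q
  · subst hpq
    rw [hd p p₀, h0]; rfl
  · by_cases hle : p ≤ q
    · exact ho p q (lt_of_le_of_ne hle hpq)
    · exact B.2.1 p q hle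

/-- A diagonal principal element of `F_S`, whose weights are 0 and 1. -/
theorem exists_isPrincipalElement_functionalA [CharZero k] [Nonempty P] {S : Finset (P × P)}
    (hideal : IsLowerSet (sources S)) (hss : ∀ p, p ∈ sinks S ∨ p ∈ sources S) :
    ∃ x : lieA k P, IsPrincipalElement k (functionalA k S) x ∧
      ∀ p q, p ≤ q → x.1 p p - x.1 q q = 0 ∨ x.1 p p - x.1 q q = 1 := by
  classical
  have hcard : (Fintype.card P : k) ≠ 0 := Nat.cast_ne_zero.2 Fintype.card_ne_zero
  -- Every edge drops from 1 to 0 under `e`, so `ad` of the diagonal matrix fixes each entry seen by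
  -- `F_S`; subtracting the mean makes the trace zero.
  let e : P → k := fun p => if p ∈ sources S then 1 else 0
  let d : P → k := fun p => e p - (∑ q, e q) / Fintype.card P
  have hd : ∀ p q, d p - d q = e p - e q := fun p q => by simp [d]
  have hx : Matrix.diagonal d ∈ lieA k P := by
    refine ⟨diagonal_mem_lieGL _, ?_⟩
    rw [Matrix.trace_diagonal, Finset.sum_sub_distrib, Finset.sum_const, nsmul_eq_mul,
        Finset.card_univ, mul_div_cancel₀ _ hcard, sub_self]
  refine ⟨⟨_, hx⟩, LinearMap.ext fun B => ?_, fun p q hpq => ?_⟩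
  · rw [kirillovForm_apply, functionalA_apply, functionalA_apply]
    refine Finset.sum_congr rfl fun s hs => ?_
    have h1 : s.2 ∉ sources S := fun h => h s.1 hs
    have h2 : s.1 ∈ sources S := (hss s.1).resolve_left fun h => h s.2 hs
    have h3 := hd s.1 s.2
    simp only [e, if_pos h2, if_neg h1, sub_zero] at h3
    rw [LieSubalgebra.coe_bracket, Ring.lie_def, Matrix.sub_apply, Matrix.diagonal_mul,
      Matrix.mul_diagonal]
    linear_combination B.1 s.1 s.2 * h3
  · simp only [Matrix.diagonal_apply_eq, hd, e]
    by_cases h1 : p ∈ sources S <;> by_cases h2 : q ∈ sources S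
    · simp [h1, h2]
    · simp [h1, h2]
    · exact absurd (hideal hpq h2) h1
    · simp [h1, h2]

/-- The `p`-th diagonal entry as a functional on `𝔤_A(P)`. -/
def diagEntry (p : P) : Module.Dual k (lieA k P) :=
  (Matrix.entryLinearMap k k p p).comp (lieA k P).toSubmodule.subtype

theorem diagEntry_apply (p : P) (B : lieA k P) : diagEntry p B = B.1 p p := rfl

theorem mul_apply_self_of_mem_lieGL {A B : Matrix P P k} (hA : A ∈ lieGL k P) (hB : B ∈ lieGL k P)
    (p : P) : (A * B) p p = A p p * B p p := by
  rw [Matrix.mul_apply, Finset.sum_eq_single p]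
  · intro r _ hr
    by_cases h1 : p ≤ r
    · rw [hB r p fun h2 => hr (le_antisymm h2 h1), mul_zero]
    · rw [hA p r h1, zero_mul]
  · simp

theorem diagEntry_lie (p : P) (A B : lieA k P) : diagEntry p ⁅A, B⁆ = 0 := by
  rw [diagEntry_apply, LieSubalgebra.coe_bracket, Ring.lie_def, Matrix.sub_apply,
    mul_apply_self_of_mem_lieGL A.2.1 B.2.1, mul_apply_self_of_mem_lieGL B.2.1 A.2.1, mul_comm,
    sub_self]

/-- On the lowest nonvanishing layer of `B`, with respect to a strictly monotone rank, bracketing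
with `y` multiplies by the weights of the diagonal part of `y`. -/
theorem lie_apply_of_vanishing {y B : Matrix P P k} (hy : y ∈ lieGL k P) {h : P → ℕ}
    (hh : StrictMono h) {m : ℕ} (hB : ∀ p q, h q < h p + m → B p q = 0) {p q : P}
    (hpq : h q ≤ h p + m) : ⁅y, B⁆ p q = (y p p - y q q) * B p q := by
  rw [Ring.lie_def, Matrix.sub_apply, Matrix.mul_apply, Matrix.mul_apply,
    Finset.sum_eq_single p, Finset.sum_eq_single q]
  · ring
  · intro r _ hr
    by_cases hrq : r ≤ q
    · have := hh (lt_of_le_of_ne hrq hr)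
      rw [hB p r (by omega), zero_mul]
    · rw [hy r q hrq, mul_zero]
  · simp
  · intro r _ hr
    by_cases hpr : p ≤ r
    · have := hh (lt_of_le_of_ne hpr (Ne.symm hr))
      rw [hB r q (by omega), mul_zero]
    · rw [hy p r hpr, zero_mul]
  · simp

/-- Layer the entries by `h q - h p`, where `h` counts the elements strictly below. On the lowest
surviving layer `ad y (ad y - 1)` multiplies by `w (w - 1)`, with `w` a weight of the diagonal of
`y`. This is zero, so each application clears one more layer. -/
theorem isNilpotent_ad_mul_ad_sub_one {y : lieA k P}
    (hy : ∀ p q, p ≤ q → y.1 p p - y.1 q q = 0 ∨ y.1 p p - y.1 q q = 1) :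
    IsNilpotent (LieAlgebra.ad k (lieA k P) y * (LieAlgebra.ad k (lieA k P) y - 1)) := by
  classical
  let h : P → ℕ := fun p => (Finset.univ.filter (· < p)).card
  have hh : StrictMono h := by
    intro p q hpq
    refine Finset.card_lt_card (Finset.ssubset_iff_of_subset ?_ |>.2 ⟨p, by simpa using hpq, by simp⟩)
    intro r hr
    simp only [Finset.mem_filter, Finset.mem_univ, true_and] at hr ⊢
    exact hr.trans hpq
  set U := LieAlgebra.ad k (lieA k P) y * (LieAlgebra.ad k (lieA k P) y - 1) with hU
  have key : ∀ (m : ℕ) (B : lieA k P) (p q : P), h q < h p + m → ((U ^ m) B).1 p q = 0 := by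
    intro m
    induction m with
    | zero =>
      intro B p q hpq
      exact B.2.1 p q fun hle => absurd (hh.monotone hle) (by omega)
    | succ m ih =>
      intro B p q hpq
      have ihB := ih B
      rw [pow_succ', Module.End.mul_apply]
      set A := (U ^ m) B
      have hA : (U A).1 = ⁅y.1, ⁅y.1, A.1⁆ - A.1⁆ := rfl
      have h1 : ∀ p q, h q ≤ h p + m →
          (⁅y.1, A.1⁆ - A.1) p q = (y.1 p p - y.1 q q - 1) * A.1 p q := by
        intro p q hpq
        rw [Matrix.sub_apply, lie_apply_of_vanishing y.2.1 hh ihB hpq]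
        ring
      have h2 : ∀ p q, h q < h p + m → (⁅y.1, A.1⁆ - A.1) p q = 0 := by
        intro p q hpq
        rw [h1 p q hpq.le, ihB p q hpq, mul_zero]
      rw [hA, lie_apply_of_vanishing y.2.1 hh h2 (by omega), h1 p q (by omega)]
      by_cases hle : p ≤ q
      · rcases hy p q hle with h0 | h0 <;> rw [h0] <;> simp
      · rw [A.2.1 p q hle, mul_zero, mul_zero]
  refine ⟨Fintype.card P + 1, LinearMap.ext fun B => Subtype.ext (Matrix.ext fun p q => ?_)⟩
  refine key _ B p q ?_
  have : h q ≤ Fintype.card P := Finset.card_le_univ _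
  omega

/-- Any principal element has the diagonal of the explicit one, because diagonal entries are
characters; the nilpotency needs only the diagonal. -/
theorem hasBinarySpectrum_lieA [CharZero k] [Nonempty P] {S : Finset (P × P)}
    (hF : IsFrobeniusFunctional k (functionalA k S))
    (hideal : IsLowerSet (sources S)) (hss : ∀ p, p ∈ sinks S ∨ p ∈ sources S) :
    HasBinarySpectrum k (lieA k P) := by
  refine ⟨hF.isFrobeniusLie, Module.finrank k (lieA k P) / 2, fun G hG y hy => ?_⟩
  obtain ⟨x, hx, hxd⟩ := exists_isPrincipalElement_functionalA (k := k) hideal hss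
  refine hy.adEigenvalues_eq hG (isNilpotent_ad_mul_ad_sub_one fun p q hpq => ?_)
  have : ∀ p, y.1 p p = x.1 p p := fun p => hy.character_eq hG hF hx (diagEntry_lie p)
  rw [this, this]
  exact hxd p q hpq

end LiePosetAlgebras

/-! ### Contractibility of the order complex, and trees. -/

section Posets

variable {P : Type*} [Fintype P] [PartialOrder P]

/-- Adding `c` to a chain leaves a chain, so the realization is star-shaped about the vertex `c`. -/
theorem contractibleSpace_orderComplexRealization {c : P} (hc : ∀ p, c ≤ p ∨ p ≤ c) :
    ContractibleSpace (orderComplexRealization P) := by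
  classical
  have hmem : Pi.single c (1 : ℝ) ∈ orderComplexRealization P := by
    refine ⟨single_mem_stdSimplex ℝ c, ?_⟩
    intro p hp q hq hne
    simp only [Set.mem_ofPred_eq, Pi.single_apply, ne_eq, ite_eq_right_iff, one_ne_zero, imp_false,
      not_not] at hp hq
    exact absurd (hp.trans hq.symm) hne
  refine StarConvex.contractibleSpace (x := Pi.single c (1 : ℝ)) ?_ ⟨_, hmem⟩
  intro w hw a b ha hb hab
  refine ⟨convex_stdSimplex ℝ P hmem.1 hw.1 ha hb hab, ?_⟩
  have hsub : {p | (a • (Pi.single c (1 : ℝ) : P → ℝ) + b • w) p ≠ 0} ⊆ insert c {p | w p ≠ 0} := by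
    intro p hp
    by_cases hpc : p = c
    · exact Or.inl hpc
    · refine Or.inr fun h => hp ?_
      simp [h, hpc]
  refine IsChain.mono hsub ?_
  exact hw.2.insert fun q _ _ => hc q

/-- A connected graph has at least one edge fewer than vertices, with equality exactly for trees;
the size of `S` bounds the edges from above. -/
theorem isSmall_of_reachable [Nonempty P] {S : Finset (P × P)} (hlt : ∀ s ∈ S, s.1 < s.2)
    (hcard : S.card + 1 ≤ Fintype.card P) {r : P}
    (hr : ∀ p, (SimpleGraph.fromRel fun p q => (p, q) ∈ S).Reachable r p) : IsSmall S := by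
  classical
  refine ⟨hlt, ?_⟩
  set Γ := SimpleGraph.fromRel fun p q => (p, q) ∈ S
  have hconn : Γ.Connected := ⟨fun p q => (hr p).symm.trans (hr q)⟩
  refine SimpleGraph.isTree_iff_connected_and_card.2 ⟨hconn, le_antisymm ?_ ?_⟩
  · rw [Nat.card_eq_fintype_card (α := P)]
    refine le_trans (Nat.add_le_add_right ?_ 1) hcard
    have hsub : Γ.edgeSet ⊆ (S.image fun s => s(s.1, s.2) : Finset (Sym2 P)) := by
      intro e
      induction e using Sym2.ind with
      | _ p q =>
        intro h
        rw [SimpleGraph.mem_edgeSet, SimpleGraph.fromRel_adj] at h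
        rw [Finset.mem_coe, Finset.mem_image]
        rcases h.2 with h | h
        · exact ⟨_, h, rfl⟩
        · exact ⟨_, h, Sym2.eq_swap⟩
    calc Nat.card Γ.edgeSet = Γ.edgeSet.ncard := rfl
      _ ≤ (S.image fun s => s(s.1, s.2) : Finset (Sym2 P)).card := by
        rw [← Set.ncard_coe_finset]
        exact Set.ncard_le_ncard hsub (Finset.finite_toSet _)
      _ ≤ S.card := Finset.card_image_le
  · exact hconn.card_vert_le_card_edgeSet_add_one

end Posets

/-! ### The combinatorial criterion and its invariance under duality. -/

section Criterion

variable (k : Type*) [Field k] {P : Type*} [Fintype P] [DecidableEq P] [PartialOrder P]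

/-- The combinatorial conditions on `(P, S)`, together with the linear system for the kernel of
the Kirillov form, which make `(P, F_S)` a toral-pair. -/
structure IsCombinatorialToralPair (S : Finset (P × P)) : Prop where
  cone : ∃ c : P, ∀ p, c ≤ p ∨ p ≤ c
  card_ext : (extremalElements P).ncard = 2 ∨ (extremalElements P).ncard = 3
  small : IsSmall S
  filter : IsUpperSet (sinks S)
  ideal : IsLowerSet (sources S)
  sink_or_source : ∀ p, p ∈ sinks S ∨ p ∈ sources S
  ext_edges : ∀ p ∈ extremalElements P, ∀ q ∈ extremalElements P, p < q → (p, q) ∈ S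
  kernel : HasScalarKernel k S

variable {k}

theorem IsCombinatorialToralPair.isToralPair [CharZero k] {S : Finset (P × P)}
    (h : IsCombinatorialToralPair k S) : IsToralPair k S := by
  obtain ⟨c, hc⟩ := h.cone
  have : Nonempty P := ⟨c⟩
  have hF := h.kernel.isFrobeniusFunctional
  exact
    { frobenius := hF.isFrobeniusLie
      frobenius_functional := hF
      card_ext := h.card_ext
      binary := hasBinarySpectrum_lieA hF h.ideal h.sink_or_source
      contractible := contractibleSpace_orderComplexRealization hc
      small := h.small
      filter := h.filter
      ideal := h.ideal
      sink_or_source := h.sink_or_source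
      ext_edges := h.ext_edges
      kernel := fun B hB => h.kernel.of_lie_eq_zero B.2 fun X hX =>
        congrArg (fun f => f (⟨X, hX⟩ : lieGL k P)) hB }

/-- The conditions are invariant under reversing the order and the edges. -/
theorem IsCombinatorialToralPair.dual {Q : Type*} [Fintype Q] [DecidableEq Q] [PartialOrder Q]
    {S : Finset (P × P)} {S' : Finset (Q × Q)} (h : IsCombinatorialToralPair k S) (e : P ≃ Q)
    (he : ∀ p q, e p ≤ e q ↔ q ≤ p) (hS : ∀ p q, (e p, e q) ∈ S' ↔ (q, p) ∈ S) :
    IsCombinatorialToralPair k S' := by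
  have hlt : ∀ p q, e p < e q ↔ q < p := fun p q => by
    rw [lt_iff_le_not_ge, lt_iff_le_not_ge, he, he]
  have hmin : ∀ p, IsMin (e p) ↔ IsMax p := fun p => by
    simp only [IsMin, IsMax, e.surjective.forall, he]
  have hmax : ∀ p, IsMax (e p) ↔ IsMin p := fun p => by
    simp only [IsMin, IsMax, e.surjective.forall, he]
  have hext : ∀ p, e p ∈ extremalElements Q ↔ p ∈ extremalElements P := fun p => by
    simp only [extremalElements, Set.mem_ofPred_eq, hmin, hmax, or_comm]
  have hsink : ∀ p, e p ∈ sinks S' ↔ p ∈ sources S := fun p => by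
    simp only [sinks, sources, Set.mem_ofPred_eq, e.surjective.forall, hS]
  have hsource : ∀ p, e p ∈ sources S' ↔ p ∈ sinks S := fun p => by
    simp only [sinks, sources, Set.mem_ofPred_eq, e.surjective.forall, hS]
  refine ⟨?_, ?_, ⟨?_, ?_⟩, ?_, ?_, ?_, ?_, ?_⟩
  · obtain ⟨c, hc⟩ := h.cone
    refine ⟨e c, e.surjective.forall.2 fun p => ?_⟩
    rw [he, he]
    exact (hc p).symm
  · have : extremalElements Q = e '' extremalElements P := by
      ext q
      obtain ⟨p, rfl⟩ := e.surjective q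
      rw [hext, e.injective.mem_set_image]
    rw [this, Set.ncard_image_of_injective _ e.injective]
    exact h.card_ext
  · rintro ⟨q, q'⟩ hq
    obtain ⟨p, rfl⟩ := e.surjective q
    obtain ⟨p', rfl⟩ := e.surjective q'
    exact (hlt _ _).2 (h.small.1 _ ((hS _ _).1 hq))
  · refine (SimpleGraph.Iso.isTree_iff ⟨e, ?_⟩).1 h.small.2
    intro p q
    simp only [SimpleGraph.fromRel_adj, hS, e.injective.ne_iff, or_comm]
  · intro q q' hqq hq
    obtain ⟨p, rfl⟩ := e.surjective q
    obtain ⟨p', rfl⟩ := e.surjective q'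
    exact (hsink _).2 (h.ideal ((he _ _).1 hqq) ((hsink _).1 hq))
  · intro q q' hqq hq
    obtain ⟨p, rfl⟩ := e.surjective q
    obtain ⟨p', rfl⟩ := e.surjective q'
    exact (hsource _).2 (h.filter ((he _ _).1 hqq) ((hsource _).1 hq))
  · refine e.surjective.forall.2 fun p => ?_
    rw [hsink, hsource]
    exact (h.sink_or_source p).symm
  · refine e.surjective.forall.2 fun p hp => e.surjective.forall.2 fun q hq hpq => ?_
    exact (hS _ _).2 (h.ext_edges q ((hext q).1 hq) p ((hext p).1 hp) ((hlt _ _).1 hpq))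
  · intro b hb hsum
    -- Transposing the matrix exchanges the two sides of each kernel equation.
    obtain ⟨h1, h2⟩ := h.kernel (fun p q => b (e q) (e p))
      (fun p q hpq => hb _ _ fun hle => hpq ((he _ _).1 hle)) fun p q hpq => by
        have := hsum (e q) (e p) ((he _ _).2 hpq)
        rw [Finset.sum_filter, Finset.sum_filter, ← e.sum_comp, ← e.sum_comp] at this
        simp only [hS] at this
        rw [Finset.sum_filter, Finset.sum_filter]
        exact this.symm
    refine ⟨e.surjective.forall.2 fun p => e.surjective.forall.2 fun q => h1 p q,
      e.surjective.forall.2 fun p => e.surjective.forall.2 fun q hpq => h2 q p ((hlt _ _).1 hpq)⟩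

end Criterion

/-! ### Passage to natural-number labels. -/

section Labels

theorem card_label (m : ℕ) : Fintype.card (Label m) = m := by
  rw [Fintype.card_of_subtype (Finset.Icc 1 m) (by simp), Nat.card_Icc, Nat.add_sub_cancel]

theorem mem_pairsOf {m : ℕ} {T : Finset (ℕ × ℕ)} {p q : Label m} :
    (p, q) ∈ pairsOf T ↔ (p.1, q.1) ∈ T := by
  simp [pairsOf]

theorem card_pairsOf_le {m : ℕ} (T : Finset (ℕ × ℕ)) : (pairsOf (m := m) T).card ≤ T.card := by
  refine Finset.card_le_card_of_injOn (fun s => (s.1.1, s.2.1)) ?_ ?_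
  · intro s hs
    exact mem_pairsOf.1 hs
  · intro s _ t _ h
    simp only [Prod.mk.injEq] at h
    exact Prod.ext (Subtype.ext h.1) (Subtype.ext h.2)

/-- The linear system of `HasScalarKernel`, rewritten for functions of two natural numbers. -/
theorem hasScalarKernel_of_label {k : Type*} [Field k] {P : Type*} [Fintype P] [DecidableEq P]
    [PartialOrder P] {S : Finset (P × P)} {m : ℕ} (e : P ≃ Label m) (r R : ℕ → ℕ → Prop)
    [∀ i, DecidablePred (R i)] [∀ j, DecidablePred fun i => R i j]
    (hr : ∀ p q, p ≤ q ↔ r (e p).1 (e q).1) (hR : ∀ p q, (p, q) ∈ S ↔ R (e p).1 (e q).1)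
    (h : ∀ b : ℕ → ℕ → k, (∀ i j, ¬ r i j → b i j = 0) →
      (∀ i j, 1 ≤ i → i ≤ m → 1 ≤ j → j ≤ m → r i j →
        ∑ s ∈ Finset.Icc 1 m with R s j, b s i = ∑ t ∈ Finset.Icc 1 m with R i t, b j t) →
      (∃ c, ∀ i, 1 ≤ i → i ≤ m → b i i = c) ∧
        ∀ i j, 1 ≤ i → i ≤ m → 1 ≤ j → j ≤ m → r i j → i ≠ j → b i j = 0) :
    HasScalarKernel k S := by
  classical
  intro b hb hsum
  have hsumIcc : ∀ (Q : ℕ → Prop) [DecidablePred Q] (f : ℕ → k),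
      ∑ s ∈ Finset.Icc 1 m with Q s, f s = ∑ s : P with Q (e s).1, f (e s).1 := by
    intro Q _ f
    symm
    refine Finset.sum_nbij (fun s => (e s).1) ?_ ?_ ?_ fun _ _ => rfl
    · intro s hs
      simp only [Finset.mem_filter, Finset.mem_univ, true_and] at hs
      simpa [hs] using (e s).2
    · intro s _ t _ hst
      exact e.injective (Subtype.ext hst)
    · intro i hi
      simp only [Finset.coe_filter, Finset.mem_Icc, Set.mem_ofPred_eq] at hi
      exact ⟨e.symm ⟨i, hi.1⟩, by simp [hi.2], by simp⟩
  let b' : ℕ → ℕ → k := fun i j =>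
    if h : (1 ≤ i ∧ i ≤ m) ∧ (1 ≤ j ∧ j ≤ m) then b (e.symm ⟨i, h.1⟩) (e.symm ⟨j, h.2⟩) else 0
  have hb' : ∀ p q, b' (e p).1 (e q).1 = b p q := by
    intro p q
    simp only [b']
    rw [dif_pos ⟨(e p).2, (e q).2⟩]
    simp
  obtain ⟨⟨c, hc⟩, ho⟩ := h b' (fun i j hij => by
      by_cases hm : (1 ≤ i ∧ i ≤ m) ∧ (1 ≤ j ∧ j ≤ m)
      · obtain ⟨p, hp⟩ := e.surjective ⟨i, hm.1⟩
        obtain ⟨q, hq⟩ := e.surjective ⟨j, hm.2⟩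
        have h1 : i = (e p).1 := by rw [hp]
        have h2 : j = (e q).1 := by rw [hq]
        rw [h1, h2, hb']
        exact hb p q fun hle => hij (by rw [h1, h2]; exact (hr p q).1 hle)
      · exact dif_neg hm)
    (fun i j hi hi' hj hj' hij => by
      obtain ⟨p, hp⟩ := e.surjective ⟨i, hi, hi'⟩
      obtain ⟨q, hq⟩ := e.surjective ⟨j, hj, hj'⟩
      have h1 : i = (e p).1 := by rw [hp]
      have h2 : j = (e q).1 := by rw [hq]
      subst h1 h2
      have := hsum p q ((hr p q).2 hij)
      rw [hsumIcc, hsumIcc]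
      simpa only [hb', hR] using this)
  refine ⟨fun p q => ?_, fun p q hpq => ?_⟩
  · rw [← hb', ← hb', hc _ (e p).2.1 (e p).2.2, hc _ (e q).2.1 (e q).2.2]
  · rw [← hb']
    exact ho _ _ (e p).2.1 (e p).2.2 (e q).2.1 (e q).2.2 ((hr p q).1 hpq.le)
      fun h => hpq.ne (e.injective (Subtype.ext h))

/-- A criterion for posets with a least element and one or two maximal elements `u` and `v`, whose
labels form a linear extension of the order, when the sources are the elements labelled `1, …, σ`
and the sink labelled `H` is joined to all of them. -/
theorem isCombinatorialToralPair_of_label {k : Type*} [Field k] {P : Type*} [Fintype P]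
    [DecidableEq P] [PartialOrder P] {S : Finset (P × P)} {m : ℕ} (e : P ≃ Label m)
    (r R : ℕ → ℕ → Prop) (hr : ∀ p q, p ≤ q ↔ r (e p).1 (e q).1)
    (hR : ∀ p q, (p, q) ∈ S ↔ R (e p).1 (e q).1) (σ H u v : ℕ)
    (hle : ∀ i j, r i j → i ≤ j)
    (hRr : ∀ i j, 1 ≤ i → i ≤ m → 1 ≤ j → j ≤ m → R i j → i ≤ σ ∧ σ < j ∧ r i j)
    (hH : 1 ≤ H ∧ H ≤ m) (hub : ∀ i, 1 ≤ i → i ≤ σ → R i H)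
    (hsink : ∀ j, σ < j → j ≤ m → ∃ i, 1 ≤ i ∧ i ≤ σ ∧ R i j)
    (hbot : ∀ j, 1 ≤ j → j ≤ m → r 1 j) (hu : 1 < u ∧ u ≤ m) (hv : 1 < v ∧ v ≤ m)
    (hu' : ∀ j, 1 ≤ j → j ≤ m → r u j → j = u) (hv' : ∀ j, 1 ≤ j → j ≤ m → r v j → j = v)
    (hmax : ∀ i, 1 ≤ i → i ≤ m → i ≠ u → i ≠ v → r i u ∨ r i v) (hRu : R 1 u) (hRv : R 1 v)
    (hcard : S.card + 1 ≤ m) (hker : HasScalarKernel k S) : IsCombinatorialToralPair k S := by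
  have hinj : ∀ p q, (e p).1 = (e q).1 → p = q := fun p q h => e.injective (Subtype.ext h)
  have hex : ∀ i, 1 ≤ i → i ≤ m → ∃ p, (e p).1 = i := fun i h1 h2 =>
    ⟨e.symm ⟨i, h1, h2⟩, by simp⟩
  have hlt : ∀ p q, p < q ↔ r (e p).1 (e q).1 ∧ (e p).1 ≠ (e q).1 := fun p q => by
    rw [lt_iff_le_and_ne, hr, ne_eq, ne_eq, not_iff_not.2 ⟨fun h => by rw [h], hinj p q⟩]
  have hRS : ∀ p q, (p, q) ∈ S → (e p).1 ≤ σ ∧ σ < (e q).1 ∧ r (e p).1 (e q).1 := fun p q h =>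
    hRr _ _ (e p).2.1 (e p).2.2 (e q).2.1 (e q).2.2 ((hR p q).1 h)
  obtain ⟨p₁, hp₁⟩ := hex 1 le_rfl (by omega)
  obtain ⟨pH, hpH⟩ := hex H hH.1 hH.2
  obtain ⟨pu, hpu⟩ := hex u hu.1.le hu.2
  obtain ⟨pv, hpv⟩ := hex v hv.1.le hv.2
  have hbot' : ∀ q, p₁ ≤ q := fun q => (hr _ _).2 (by rw [hp₁]; exact hbot _ (e q).2.1 (e q).2.2)
  have hub' : ∀ p, (e p).1 ≤ σ → (p, pH) ∈ S := fun p hp =>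
    (hR _ _).2 (by rw [hpH]; exact hub _ (e p).2.1 hp)
  have hext : ∀ p, p ∈ extremalElements P ↔ p = p₁ ∨ p = pu ∨ p = pv := by
    intro p
    constructor
    · rintro (h | h)
      · have := h (hbot' p)
        rw [hr, hp₁] at this
        have := hle _ _ this
        have := (e p).2.1
        exact Or.inl (hinj _ _ (by omega))
      · by_contra! hne
        have h1 : (e p).1 ≠ u := fun h => hne.2.1 (hinj _ _ (h.trans hpu.symm))
        have h2 : (e p).1 ≠ v := fun h => hne.2.2 (hinj _ _ (h.trans hpv.symm))
        rcases hmax _ (e p).2.1 (e p).2.2 h1 h2 with h3 | h3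
        · rw [← hpu, ← hr] at h3
          exact hne.2.1 (le_antisymm h3 (h h3))
        · rw [← hpv, ← hr] at h3
          exact hne.2.2 (le_antisymm h3 (h h3))
    · rintro (rfl | rfl | rfl)
      · exact Or.inl fun q _ => hbot' q
      · refine Or.inr fun q hq => ?_
        rw [hr, hpu] at hq
        exact (hinj q p ((hu' _ (e q).2.1 (e q).2.2 hq).trans hpu.symm)).le
      · refine Or.inr fun q hq => ?_
        rw [hr, hpv] at hq
        exact (hinj q p ((hv' _ (e q).2.1 (e q).2.2 hq).trans hpv.symm)).le
  have hsinks : ∀ p, p ∈ sinks S ↔ σ < (e p).1 := by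
    intro p
    constructor
    · intro h
      by_contra! hne
      exact h pH (hub' p hne)
    · intro h q hq
      have := (hRS _ _ hq).1
      omega
  have hsources : ∀ p, p ∈ sources S ↔ (e p).1 ≤ σ := by
    intro p
    constructor
    · intro h
      by_contra! hne
      obtain ⟨i, h1, h2, h3⟩ := hsink _ hne (e p).2.2
      obtain ⟨q, rfl⟩ := hex i h1 (by have := (e p).2.2; omega)
      exact h q ((hR _ _).2 h3)
    · intro h q hq
      have := (hRS _ _ hq).2.1
      omega
  have h1u : p₁ ≠ pu := by rintro rfl; omega
  have h1v : p₁ ≠ pv := by rintro rfl; omega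
  refine ⟨⟨p₁, fun p => Or.inl (hbot' p)⟩, ?_, ?_, ?_, ?_, ?_,
    ?_, hker⟩
  · by_cases huv : pu = pv
    · refine Or.inl (Set.ncard_eq_two.2 ⟨p₁, pu, h1u, ?_⟩)
      ext p
      rw [hext, huv, or_self]; rfl
    · refine Or.inr (Set.ncard_eq_three.2 ⟨p₁, pu, pv, h1u, h1v, huv, ?_⟩)
      ext p
      exact hext p
  · have : Nonempty P := ⟨p₁⟩
    have adj : ∀ p q, (p, q) ∈ S →
        (SimpleGraph.fromRel fun p q => (p, q) ∈ S).Reachable p q := by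
      intro p q h
      refine SimpleGraph.Adj.reachable ((SimpleGraph.fromRel_adj _ _ _).2 ⟨?_, Or.inl h⟩)
      rintro rfl
      have := hRS _ _ h
      omega
    have hsrc : ∀ p, (e p).1 ≤ σ →
        (SimpleGraph.fromRel fun p q => (p, q) ∈ S).Reachable pH p := fun p hp =>
      (adj p pH (hub' p hp)).symm
    -- Every source is adjacent to the hub, and every sink to some source.
    refine isSmall_of_reachable (r := pH) ?_ ?_ fun p => ?_
    · rintro ⟨p, q⟩ h
      have := hRS p q h
      exact (hlt p q).2 ⟨this.2.2, (this.1.trans_lt this.2.1).ne⟩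
    · rwa [Fintype.card_congr e, card_label]
    · by_cases hp : (e p).1 ≤ σ
      · exact hsrc p hp
      · obtain ⟨i, h1, h2, h3⟩ := hsink _ (not_le.1 hp) (e p).2.2
        obtain ⟨q, rfl⟩ := hex i h1 (by have := (e p).2.2; omega)
        exact (hsrc q h2).trans (adj q p ((hR _ _).2 h3))
  · intro p q hpq hp
    rw [hsinks] at hp ⊢
    exact hp.trans_le (hle _ _ ((hr _ _).1 hpq))
  · intro p q hpq hp
    rw [hsources] at hp ⊢
    exact (hle _ _ ((hr _ _).1 hpq)).trans hp
  · intro p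
    rw [hsinks, hsources]
    exact lt_or_ge _ _
  · intro p hp q hq hpq
    rw [hext] at hp hq
    rw [hlt] at hpq
    have hup : (e p).1 ≠ u := fun h => hpq.2
      ((hu' _ (e q).2.1 (e q).2.2 (h ▸ hpq.1)).trans h.symm).symm
    have hvp : (e p).1 ≠ v := fun h => hpq.2
      ((hv' _ (e q).2.1 (e q).2.2 (h ▸ hpq.1)).trans h.symm).symm
    rcases hp with rfl | rfl | rfl
    · rcases hq with rfl | rfl | rfl
      · exact absurd rfl hpq.2
      · exact (hR _ _).2 (by rwa [hp₁, hpu])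
      · exact (hR _ _).2 (by rwa [hp₁, hpv])
    · exact absurd hpu hup
    · exact absurd hpv hvp

variable {k : Type*} [Field k] {m : ℕ} {R : ℕ → Prop} [DecidablePred R]

theorem sum_Icc_filter_eq_zero (f : ℕ → k) (h : ∀ s, 1 ≤ s → s ≤ m → ¬ R s) :
    ∑ s ∈ Finset.Icc 1 m with R s, f s = 0 := by
  refine Finset.sum_eq_zero fun s hs => ?_
  simp only [Finset.mem_filter, Finset.mem_Icc] at hs
  exact absurd hs.2 (h s hs.1.1 hs.1.2)

theorem sum_Icc_filter_eq_single (f : ℕ → k) (a : ℕ) (ha : 1 ≤ a ∧ a ≤ m ∧ R a)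
    (h : ∀ s, 1 ≤ s → s ≤ m → R s → s ≠ a → f s = 0) :
    ∑ s ∈ Finset.Icc 1 m with R s, f s = f a := by
  refine Finset.sum_eq_single_of_mem a ?_ fun s hs hsa => ?_
  · simp [ha]
  · simp only [Finset.mem_filter, Finset.mem_Icc] at hs
    exact h s hs.1.1 hs.1.2 hs.2 hsa

theorem sum_Icc_filter_eq_pair (f : ℕ → k) (a b : ℕ) (hab : a ≠ b)
    (h : ∀ s, 1 ≤ s ∧ s ≤ m ∧ R s ↔ s = a ∨ s = b) :
    ∑ s ∈ Finset.Icc 1 m with R s, f s = f a + f b := by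
  have : (Finset.Icc 1 m).filter R = {a, b} := by
    ext s
    simp only [Finset.mem_filter, Finset.mem_Icc, Finset.mem_insert, Finset.mem_singleton, ← h s,
      and_assoc]
  rw [this, Finset.sum_pair hab]

end Labels

/-! ### The six-element poset. -/

section P3

theorem P3.le_iff {p q : P3} : p ≤ q ↔ p.1 = q.1 ∨ (p.1 < q.1 ∧ (p.1 ≤ 2 ∨ q.1 = p.1 + 2)) := Iff.rfl

theorem mem_S3 {p q : P3} : (p, q) ∈ S3 ↔ p.1 = 1 ∧ q.1 = 5 ∨ p.1 = 1 ∧ q.1 = 6 ∨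
    p.1 = 2 ∧ q.1 = 3 ∨ p.1 = 2 ∧ q.1 = 4 ∨ p.1 = 2 ∧ q.1 = 6 := by
  refine mem_pairsOf.trans ?_
  simp

theorem hasScalarKernel_S3 (k : Type*) [Field k] : HasScalarKernel k S3 := by
  refine hasScalarKernel_of_label (m := 6) (Equiv.refl _)
    (fun i j => i = j ∨ (i < j ∧ (i ≤ 2 ∨ j = i + 2)))
    (fun i j => i = 1 ∧ j = 5 ∨ i = 1 ∧ j = 6 ∨ i = 2 ∧ j = 3 ∨ i = 2 ∧ j = 4 ∨ i = 2 ∧ j = 6)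
    (fun p q => P3.le_iff) (fun p q => mem_S3) ?_
  intro b hb E
  have hI : Finset.Icc 1 6 = {1, 2, 3, 4, 5, 6} := rfl
  simp only [Finset.sum_filter, hI] at E
  -- The equations at all comparable pairs, then the zero entries that occur in them.
  have e11 := E 1 1; have e12 := E 1 2; have e22 := E 2 2; have e33 := E 3 3; have e44 := E 4 4
  have e55 := E 5 5; have e66 := E 6 6; have e35 := E 3 5; have e46 := E 4 6
  have e13 := E 1 3; have e23 := E 2 3; have e14 := E 1 4; have e24 := E 2 4
  have e15 := E 1 5; have e25 := E 2 5; have e16 := E 1 6; have e26 := E 2 6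
  have z21 := hb 2 1; have z34 := hb 3 4; have z36 := hb 3 6; have z43 := hb 4 3
  have z45 := hb 4 5; have z53 := hb 5 3; have z54 := hb 5 4; have z56 := hb 5 6
  have z63 := hb 6 3; have z64 := hb 6 4; have z65 := hb 6 5
  simp at e11 e12 e22 e33 e44 e55 e66 e35 e46 e13 e23 e14 e24 e15 e25 e16 e26
  simp at z21 z34 z36 z43 z45 z53 z54 z56 z63 z64 z65
  clear E hI hb
  refine ⟨⟨b 6 6, fun i hi hi' => ?_⟩, fun i j hi hi' hj hj' hij hne => ?_⟩
  · interval_cases i <;> grind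
  · interval_cases i <;> interval_cases j <;> first | (exfalso; lia) | grind

theorem isCombinatorialToralPair_S3 (k : Type*) [Field k] : IsCombinatorialToralPair k S3 := by
  refine isCombinatorialToralPair_of_label (m := 6) (Equiv.refl _)
    (fun i j => i = j ∨ (i < j ∧ (i ≤ 2 ∨ j = i + 2)))
    (fun i j => i = 1 ∧ j = 5 ∨ i = 1 ∧ j = 6 ∨ i = 2 ∧ j = 3 ∨ i = 2 ∧ j = 4 ∨ i = 2 ∧ j = 6)
    (fun p q => P3.le_iff) (fun p q => mem_S3) 2 6 5 6 (fun i j => by lia)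
    (fun i j => by lia) (by lia) (fun i => by lia) ?_ (fun j => by lia) (by lia) (by lia)
    (fun j => by lia) (fun j => by lia) (fun i => by lia) (by lia) (by lia)
    (Nat.add_le_add_right (card_pairsOf_le _) 1) (hasScalarKernel_S3 k)
  intro j h1 h2
  by_cases h : j = 5
  · exact ⟨1, by lia⟩
  · exact ⟨2, by lia⟩

end P3

/-! ### The chain that forks at its middle. -/

section P4

variable {n : ℕ}

theorem P4.le_iff {p q : P4 n} :
    p ≤ q ↔ p.1 = q.1 ∨ (p.1 < q.1 ∧ (q.1 ≤ n - 1 ∨ p.1 ≤ n / 2)) := Iff.rfl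

theorem mem_S4 {p q : P4 n} : (p, q) ∈ S4 n ↔
    p.1 + q.1 = n ∧ p.1 ≤ (n - 1) / 2 ∨ q.1 = n ∧ p.1 ≤ n / 2 := by
  refine mem_pairsOf.trans ?_
  have hp := p.2
  simp only [Finset.mem_union, Finset.mem_image, Finset.mem_Icc, Prod.mk.injEq]
  constructor
  · rintro (⟨a, h⟩ | ⟨a, h⟩) <;> lia
  · rintro (h | h)
    · exact Or.inl ⟨p.1, by lia⟩
    · exact Or.inr ⟨p.1, by lia⟩

theorem card_S4_add_one_le (hn : 2 ≤ n) : (S4 n).card + 1 ≤ n := by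
  have h1 := card_pairsOf_le (m := n) (
    (Finset.Icc 1 ((n - 1) / 2)).image (fun i => (i, n - i)) ∪
    (Finset.Icc 1 (n / 2)).image (fun i => (i, n)))
  have h2 := Finset.card_union_le ((Finset.Icc 1 ((n - 1) / 2)).image (fun i => (i, n - i)))
    ((Finset.Icc 1 (n / 2)).image (fun i => (i, n)))
  have h3 := Finset.card_image_le (s := Finset.Icc 1 ((n - 1) / 2)) (f := fun i => (i, n - i))
  have h4 := Finset.card_image_le (s := Finset.Icc 1 (n / 2)) (f := fun i => (i, n))
  rw [Nat.card_Icc] at h3 h4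
  have h5 : (S4 n).card = (pairsOf (m := n) (
    (Finset.Icc 1 ((n - 1) / 2)).image (fun i => (i, n - i)) ∪
    (Finset.Icc 1 (n / 2)).image (fun i => (i, n)))).card := rfl
  lia

/-- The sources are `1, …, ⌊n/2⌋`, the hub is `n`, and `i ↦ n - i` is the matching; for even `n` the
source `n/2` is joined to the hub only. In the step names `A`, `D`, `C` are the source-source,
source-sink and sink-sink blocks. -/
theorem hasScalarKernel_S4 (k : Type*) [Field k] (hn : 2 ≤ n) : HasScalarKernel k (S4 n) := by
  refine hasScalarKernel_of_label (m := n) (Equiv.refl _)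
    (fun i j => i = j ∨ (i < j ∧ (j ≤ n - 1 ∨ i ≤ n / 2)))
    (fun i j => i + j = n ∧ i ≤ (n - 1) / 2 ∨ j = n ∧ i ≤ n / 2)
    (fun p q => P4.le_iff) (fun p q => mem_S4) ?_
  intro b hb E
  have col_source : ∀ q, q ≤ n / 2 → ∀ p, ∑ s ∈ Finset.Icc 1 n with
      (s + q = n ∧ s ≤ (n - 1) / 2 ∨ q = n ∧ s ≤ n / 2), b s p = 0 :=
    fun q hq p => sum_Icc_filter_eq_zero _ fun s => by lia
  have col_sink : ∀ q, n / 2 < q → q < n → ∀ p, ∑ s ∈ Finset.Icc 1 n with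
      (s + q = n ∧ s ≤ (n - 1) / 2 ∨ q = n ∧ s ≤ n / 2), b s p = b (n - q) p :=
    fun q hq hq' p => sum_Icc_filter_eq_single _ _ (by lia) fun s => by lia
  have row_sink : ∀ p, n / 2 < p → ∀ q, ∑ t ∈ Finset.Icc 1 n with
      (p + t = n ∧ p ≤ (n - 1) / 2 ∨ t = n ∧ p ≤ n / 2), b q t = 0 :=
    fun p hp q => sum_Icc_filter_eq_zero _ fun s => by lia
  have row_pair : ∀ p, 1 ≤ p → p ≤ (n - 1) / 2 → ∀ q, ∑ t ∈ Finset.Icc 1 n with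
      (p + t = n ∧ p ≤ (n - 1) / 2 ∨ t = n ∧ p ≤ n / 2), b q t = b q (n - p) + b q n :=
    fun p hp hp' q => sum_Icc_filter_eq_pair _ _ _ (by lia) fun s => by lia
  have row_single : ∀ p, (n - 1) / 2 < p → p ≤ n / 2 → ∀ q, ∑ t ∈ Finset.Icc 1 n with
      (p + t = n ∧ p ≤ (n - 1) / 2 ∨ t = n ∧ p ≤ n / 2), b q t = b q n :=
    fun p hp hp' q => sum_Icc_filter_eq_single _ _ (by lia) fun s => by lia
  have hubD : ∀ q, 1 ≤ q → q ≤ n / 2 → b q n = 0 := by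
    intro q h1 h2
    have e1 := E q q h1 (by lia) h1 (by lia) (by lia)
    rw [col_source q h2] at e1
    by_cases hq : q ≤ (n - 1) / 2
    · have e2 := E (n - q) (n - q) (by lia) (by lia) (by lia) (by lia) (by lia)
      rw [row_sink _ (by lia), col_sink _ (by lia) (by lia), Nat.sub_sub_self (by lia)] at e2
      rw [row_pair q h1 hq, e2, zero_add] at e1
      exact e1.symm
    · rw [row_single q (by lia) h2] at e1
      exact e1.symm
  -- Either `n - t ≤ q`, or else `t ≤ n - q`: the entry is isolated by an equation between two
  -- sources or between two sinks.
  have hD : ∀ q t, 1 ≤ q → q ≤ n / 2 → n / 2 < t → t < n → b q t = 0 := by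
    intro q t h1 h2 h3 h4
    by_cases hq : n - t ≤ q
    · have e1 := E (n - t) q (by lia) (by lia) h1 (by lia) (by lia)
      rw [col_source q h2, row_pair _ (by lia) (by lia), Nat.sub_sub_self (by lia), hubD q h1 h2,
        add_zero] at e1
      exact e1.symm
    · have e1 := E t (n - q) (by lia) (by lia) (by lia) (by lia) (by lia)
      rwa [col_sink _ (by lia) (by lia), row_sink _ (by lia), Nat.sub_sub_self (by lia)] at e1
  have hAC : ∀ i p, 1 ≤ i → i ≤ (n - 1) / 2 → 1 ≤ p → p ≤ (n - 1) / 2 →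
      b i p = b (n - i) (n - p) := by
    intro i p h1 h2 h3 h4
    have e1 := E p (n - i) (by lia) (by lia) (by lia) (by lia) (by lia)
    rw [col_sink _ (by lia) (by lia), row_pair _ h3 h4, Nat.sub_sub_self (by lia),
      hb (n - i) n (by lia), add_zero] at e1
    exact e1
  -- The matching reverses the order, so the partner entry lies below the diagonal.
  have hA : ∀ i p, 1 ≤ i → i < p → p ≤ n / 2 → b i p = 0 := by
    intro i p h1 h2 h3
    by_cases hp : p ≤ (n - 1) / 2
    · rw [hAC i p h1 (by lia) (by lia) hp]
      exact hb _ _ (by lia)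
    · have e1 := E p (n - i) (by lia) (by lia) (by lia) (by lia) (by lia)
      rw [col_sink _ (by lia) (by lia), row_single _ (by lia) h3, Nat.sub_sub_self (by lia),
        hb (n - i) n (by lia)] at e1
      exact e1
  -- In the equation at `(p, n)` the hub column sums over all sources, but only the diagonal term
  -- survives.
  have hdiag : ∀ p, 1 ≤ p → p ≤ n / 2 → b p p = b n n := by
    intro p h1 h2
    have e1 := E p n h1 (by lia) (by lia) (by lia) (by lia)
    rw [sum_Icc_filter_eq_single _ p (by lia) fun s hs hs' hR hsp => by
      by_cases hlt : s < p
      · exact hA s p hs hlt h2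
      · exact hb s p (by lia)] at e1
    by_cases hp : p ≤ (n - 1) / 2
    · rw [e1, row_pair p h1 hp, hb n (n - p) (by lia), zero_add]
    · rw [e1, row_single p (by lia) h2]
  refine ⟨⟨b n n, fun i h1 h2 => ?_⟩, fun i j h1 h2 h3 h4 hij hne => ?_⟩
  · by_cases hi : i ≤ n / 2
    · exact hdiag i h1 hi
    · by_cases hin : i = n
      · rw [hin]
      · have := hAC (n - i) (n - i) (by lia) (by lia) (by lia) (by lia)
        rw [Nat.sub_sub_self (by lia)] at this
        rw [← this, hdiag _ (by lia) (by lia)]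
  · by_cases hi : i ≤ n / 2
    · by_cases hj : j ≤ n / 2
      · exact hA i j h1 (by lia) hj
      · by_cases hjn : j = n
        · rw [hjn]
          exact hubD i h1 hi
        · exact hD i j h1 hi (by lia) (by lia)
    · have := hAC (n - i) (n - j) (by lia) (by lia) (by lia) (by lia)
      rw [Nat.sub_sub_self (by lia), Nat.sub_sub_self (by lia)] at this
      rw [← this]
      exact hb _ _ (by lia)

theorem isCombinatorialToralPair_S4 (k : Type*) [Field k] (hn : 2 ≤ n) :
    IsCombinatorialToralPair k (S4 n) := by
  refine isCombinatorialToralPair_of_label (m := n) (Equiv.refl _)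
    (fun i j => i = j ∨ (i < j ∧ (j ≤ n - 1 ∨ i ≤ n / 2)))
    (fun i j => i + j = n ∧ i ≤ (n - 1) / 2 ∨ j = n ∧ i ≤ n / 2)
    -- The maximal elements are `n` and `n - 1`, except for `n = 2`, where `n - 1` is the minimum
    -- and the `max` makes both equal to `2`.
    (fun p q => P4.le_iff) (fun p q => mem_S4) (n / 2) n n (max 2 (n - 1))
    (fun i j => by lia) (fun i j => by lia) (by lia) (fun i => by lia) ?_ (fun j => by lia)
    (by lia) (by lia) (fun j => by lia) (fun j => by lia) (fun i => by lia) (by lia) (by lia)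
    (card_S4_add_one_le hn) (hasScalarKernel_S4 k hn)
  intro j h1 h2
  by_cases h : j = n
  · exact ⟨1, by lia⟩
  · exact ⟨n - j, by lia⟩

end P4

/-! ### The ordinal sum of a point and `n` two-element antichains. -/

section P5

variable {n : ℕ}

/-- The levels are `{1}, {2, 3}, …, {2n, 2n + 1}`, and `i / 2` is the level of `i`. -/
theorem P5.le_iff {p q : P5 n} : p ≤ q ↔ p.1 = q.1 ∨ p.1 / 2 < q.1 / 2 := by
  have h : p ≤ q ↔ p.1 = q.1 ∨ (p.1 % 2 = 1 ∧ p.1 + 1 ≤ q.1) ∨ (p.1 % 2 = 0 ∧ p.1 + 2 ≤ q.1) :=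
    Iff.rfl
  rw [h]
  lia

/-- The order-reversing matching of the levels of `P5 n`; the edges of `S5 n` which do not end in
`2n` join matched elements. -/
def levelMatch (n i : ℕ) : ℕ := 2 * n + 2 * (i % 2) - i

theorem mem_S5 {p q : P5 n} : (p, q) ∈ S5 n ↔
    q.1 = levelMatch n p.1 ∧ p.1 ≤ 2 * ((n - 1) / 2) + 1 ∨
      q.1 = 2 * n ∧ p.1 ≤ 2 * (n / 2) + 1 := by
  refine mem_pairsOf.trans ?_
  have hp := p.2
  have hq := q.2
  simp only [Finset.mem_union, Finset.mem_image, Finset.mem_Icc, Prod.mk.injEq,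
    Finset.mem_singleton, levelMatch]
  constructor
  · rintro (((h | ⟨a, h⟩) | ⟨a, h⟩) | ⟨a, h⟩) <;> lia
  · rintro (h | h)
    · by_cases h1 : p.1 = 1
      · exact Or.inl (Or.inl (Or.inl (by lia)))
      · by_cases h2 : p.1 % 2 = 0
        · exact Or.inl (Or.inr ⟨p.1 / 2, by lia⟩)
        · exact Or.inr ⟨p.1 / 2, by lia⟩
    · exact Or.inl (Or.inl (Or.inr ⟨p.1, by lia⟩))

theorem card_S5_add_one_le (hn : 1 ≤ n) : (S5 n).card + 1 ≤ 2 * n + 1 := by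
  refine Nat.add_le_add_right ((card_pairsOf_le _).trans ?_) 1
  refine (Finset.card_union_le _ _).trans ?_
  refine (Nat.add_le_add ((Finset.card_union_le _ _).trans (Nat.add_le_add
    ((Finset.card_union_le _ _).trans (Nat.add_le_add (Finset.card_singleton _).le
      Finset.card_image_le)) Finset.card_image_le)) Finset.card_image_le).trans ?_
  simp only [Nat.card_Icc]
  lia

/-- The block argument of `hasScalarKernel_S4` with hub `2n` and matching `levelMatch`. Two elements
of one level are incomparable, so some entries need an additional equation. The sources are `1, …,
σ`, the matched ones `1, …, l`; for even `n` the two sources of the middle level are joined to the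
hub only. -/
theorem hasScalarKernel_S5 (k : Type*) [Field k] (hn : 1 ≤ n) : HasScalarKernel k (S5 n) := by
  refine hasScalarKernel_of_label (m := 2 * n + 1) (Equiv.refl _)
    (fun i j => i = j ∨ i / 2 < j / 2)
    (fun i j => j = levelMatch n i ∧ i ≤ 2 * ((n - 1) / 2) + 1 ∨ j = 2 * n ∧ i ≤ 2 * (n / 2) + 1)
    (fun p q => P5.le_iff) (fun p q => mem_S5) ?_
  intro b hb E
  generalize hl : 2 * ((n - 1) / 2) + 1 = l at E
  generalize hσ : 2 * (n / 2) + 1 = σ at E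
  have match_sink : ∀ i, 1 ≤ i → i ≤ l →
      σ < levelMatch n i ∧ levelMatch n i ≤ 2 * n + 1 ∧ levelMatch n i ≠ 2 * n := by
    intro i; unfold levelMatch; lia
  -- The hub is excluded because `levelMatch n (2 * n) = 0` is not a label.
  have match_source : ∀ j, σ < j → j ≤ 2 * n + 1 → j ≠ 2 * n →
      1 ≤ levelMatch n j ∧ levelMatch n j ≤ l := by
    intro i; unfold levelMatch; lia
  have match_match : ∀ i, i ≤ 2 * n + 1 → levelMatch n (levelMatch n i) = i := by
    intro i; unfold levelMatch; lia
  have match_level : ∀ i, i ≤ 2 * n + 1 → levelMatch n i / 2 = n - i / 2 := by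
    intro i; unfold levelMatch; lia
  have match_inj : ∀ i j, i ≤ 2 * n + 1 → j ≤ 2 * n + 1 → levelMatch n i = levelMatch n j →
      i = j := by
    intro i j; unfold levelMatch; lia
  have hlσ : l ≤ σ ∧ σ < 2 * n ∧ 1 ≤ l ∧ σ ≤ l + 2 ∧ l % 2 = 1 ∧ σ % 2 = 1 := by lia
  clear hl
  have col_source : ∀ q, q ≤ σ → ∀ p, ∑ s ∈ Finset.Icc 1 (2 * n + 1) with
      (q = levelMatch n s ∧ s ≤ l ∨ q = 2 * n ∧ s ≤ σ), b s p = 0 := by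
    intro q hq p
    refine sum_Icc_filter_eq_zero _ fun s h1 h2 => ?_
    have := match_sink s
    lia
  have col_sink : ∀ i, 1 ≤ i → i ≤ l → ∀ p, ∑ s ∈ Finset.Icc 1 (2 * n + 1) with
      (levelMatch n i = levelMatch n s ∧ s ≤ l ∨ levelMatch n i = 2 * n ∧ s ≤ σ), b s p =
        b i p := by
    intro i h1 h2 p
    have := match_sink i
    refine sum_Icc_filter_eq_single _ _ (by lia) fun s h3 h4 => ?_
    have := match_inj i s
    lia
  have row_sink : ∀ p, σ < p → ∀ q, ∑ t ∈ Finset.Icc 1 (2 * n + 1) with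
      (t = levelMatch n p ∧ p ≤ l ∨ t = 2 * n ∧ p ≤ σ), b q t = 0 :=
    fun p hp q => sum_Icc_filter_eq_zero _ fun s => by lia
  have row_pair : ∀ p, 1 ≤ p → p ≤ l → ∀ q, ∑ t ∈ Finset.Icc 1 (2 * n + 1) with
      (t = levelMatch n p ∧ p ≤ l ∨ t = 2 * n ∧ p ≤ σ), b q t =
        b q (levelMatch n p) + b q (2 * n) := by
    intro p h1 h2 q
    have := match_sink p
    exact sum_Icc_filter_eq_pair _ _ _ (by lia) fun s => by lia
  have row_single : ∀ p, l < p → p ≤ σ → ∀ q, ∑ t ∈ Finset.Icc 1 (2 * n + 1) with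
      (t = levelMatch n p ∧ p ≤ l ∨ t = 2 * n ∧ p ≤ σ), b q t = b q (2 * n) :=
    fun p hp hp' q => sum_Icc_filter_eq_single _ _ (by lia) fun s => by lia
  have hself : ∀ q, 1 ≤ q → q ≤ l → b q (levelMatch n q) = 0 := by
    intro q h1 h2
    have h3 := match_sink q h1 h2
    have e2 := E (levelMatch n q) (levelMatch n q) (by lia) (by lia) (by lia) (by lia) (by lia)
    rwa [row_sink _ (by lia), col_sink q h1 h2] at e2
  have hubD : ∀ q, 1 ≤ q → q ≤ σ → b q (2 * n) = 0 := by
    intro q h1 h2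
    have e1 := E q q h1 (by lia) h1 (by lia) (by lia)
    rw [col_source q h2] at e1
    by_cases hq : q ≤ l
    · rw [row_pair q h1 hq, hself q h1 hq, zero_add] at e1
      exact e1.symm
    · rw [row_single q (by lia) h2] at e1
      exact e1.symm
  have hD' : ∀ q p, 1 ≤ q → q ≤ σ → 1 ≤ p → p ≤ l → (q / 2 = p / 2 → q = p) →
      b q (levelMatch n p) = 0 := by
    intro q p h1 h2 h3 h4 hne
    have hp := match_sink p h3 h4
    rcases lt_trichotomy (q / 2) (p / 2) with h | h | h
    · have hq := match_sink q h1 (by lia)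
      have e1 := E (levelMatch n p) (levelMatch n q) (by lia) (by lia) (by lia) (by lia) (by
        have := match_level p; have := match_level q; lia)
      rwa [col_sink q h1 (by lia), row_sink _ (by lia)] at e1
    · rw [hne h]
      exact hself p h3 h4
    · have e1 := E p q h3 (by lia) h1 (by lia) (by lia)
      rw [col_source q h2, row_pair p h3 h4, hubD q h1 h2, add_zero] at e1
      exact e1.symm
  -- If `q` and `p` are distinct on one level, the equation at `(levelMatch n p, 2n)` is used: its
  -- hub column sums over all sources, and `hD'` kills every term but that of `q`.
  have hD : ∀ q p, 1 ≤ q → q ≤ σ → 1 ≤ p → p ≤ l → b q (levelMatch n p) = 0 := by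
    intro q p h1 h2 h3 h4
    by_cases hne : q / 2 = p / 2 → q = p
    · exact hD' q p h1 h2 h3 h4 hne
    · have hp := match_sink p h3 h4
      have e1 := E (levelMatch n p) (2 * n) (by lia) (by lia) (by lia) (by lia) (by
        have := match_level p; lia)
      rwa [row_sink _ (by lia), sum_Icc_filter_eq_single _ q (by lia) fun s hs hs' hR hsq =>
        hD' s p hs (by lia) h3 h4 (by lia)] at e1
  -- With `j` the other element of the level of `i`, the equation at `(j, levelMatch n i)` involves
  -- this entry and two entries at incomparable pairs. The level of `1` is a singleton, but its
  -- partner `2n + 1` is incomparable to the hub.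
  have hub : ∀ i, 1 ≤ i → i ≤ l → b (levelMatch n i) (2 * n) = 0 := by
    intro i h1 h2
    have hi := match_sink i h1 h2
    have hi' := match_level i
    by_cases h : i = 1
    · exact hb _ _ (by lia)
    · have hj : ∃ j, 1 ≤ j ∧ j ≤ l ∧ j ≠ i ∧ j / 2 = i / 2 := by
        by_cases hpar : i % 2 = 0
        · exact ⟨i + 1, by lia⟩
        · exact ⟨i - 1, by lia⟩
      obtain ⟨j, hj1, hj2, hj3, hj4⟩ := hj
      have hj5 := match_level j
      have hj6 := match_inj i j
      have e1 := E j (levelMatch n i) (by lia) (by lia) (by lia) (by lia) (by lia)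
      rw [col_sink i h1 h2, row_pair j hj1 hj2, hb i j (by lia),
        hb (levelMatch n i) (levelMatch n j) (by lia), zero_add] at e1
      exact e1.symm
  have hAC : ∀ i p, 1 ≤ i → i ≤ l → 1 ≤ p → p ≤ l →
      b i p = b (levelMatch n i) (levelMatch n p) := by
    intro i p h1 h2 h3 h4
    have hi := match_sink i h1 h2
    have hi' := match_level i
    have e1 := E p (levelMatch n i) (by lia) (by lia) (by lia) (by lia) (by lia)
    rwa [col_sink i h1 h2, row_pair _ h3 h4, hub i h1 h2, add_zero] at e1
  have hA : ∀ i p, 1 ≤ i → i / 2 < p / 2 → p ≤ σ → b i p = 0 := by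
    intro i p h1 h2 h3
    have hi := match_sink i h1 (by lia)
    have hi' := match_level i
    by_cases hp : p ≤ l
    · rw [hAC i p h1 (by lia) (by lia) hp]
      have := match_level p
      exact hb _ _ (by lia)
    · have e1 := E p (levelMatch n i) (by lia) (by lia) (by lia) (by lia) (by lia)
      rwa [col_sink i h1 (by lia), row_single _ (by lia) h3, hub i h1 (by lia)] at e1
  have hdiag : ∀ p, 1 ≤ p → p ≤ σ → b p p = b (2 * n) (2 * n) := by
    intro p h1 h2
    have e1 := E p (2 * n) h1 (by lia) (by lia) (by lia) (by lia)
    rw [sum_Icc_filter_eq_single _ p (by lia) fun s hs hs' hR hsp => by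
      by_cases hlt : s / 2 < p / 2
      · exact hA s p hs hlt h2
      · exact hb s p (by lia)] at e1
    by_cases hp : p ≤ l
    · have := match_sink p h1 hp
      rw [e1, row_pair p h1 hp, hb (2 * n) (levelMatch n p) (by lia), zero_add]
    · rw [e1, row_single p (by lia) h2]
  refine ⟨⟨b (2 * n) (2 * n), fun i h1 h2 => ?_⟩, fun i j h1 h2 h3 h4 hij hne => ?_⟩
  · by_cases hi : i ≤ σ
    · exact hdiag i h1 hi
    · by_cases hin : i = 2 * n
      · rw [hin]
      · have hs := match_source i (by lia) h2 hin
        have := hAC _ _ hs.1 hs.2 hs.1 hs.2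
        rw [match_match i h2] at this
        rw [← this, hdiag _ hs.1 (by lia)]
  · by_cases hi : i ≤ σ
    · by_cases hj : j ≤ σ
      · exact hA i j h1 (by lia) hj
      · by_cases hjn : j = 2 * n
        · rw [hjn]
          exact hubD i h1 hi
        · have hs := match_source j (by lia) h4 hjn
          rw [← match_match j h4]
          exact hD i _ h1 hi hs.1 hs.2
    · have hs := match_source i (by lia) h2 (by lia)
      rw [← match_match i h2]
      by_cases hjn : j = 2 * n
      · rw [hjn]
        exact hub _ hs.1 hs.2
      · have ht := match_source j (by lia) h4 hjn
        rw [← match_match j h4, ← hAC _ _ hs.1 hs.2 ht.1 ht.2]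
        have := match_level i h2
        have := match_level j h4
        exact hb _ _ (by lia)

theorem isCombinatorialToralPair_S5 (k : Type*) [Field k] (hn : 1 ≤ n) :
    IsCombinatorialToralPair k (S5 n) := by
  refine isCombinatorialToralPair_of_label (m := 2 * n + 1) (Equiv.refl _)
    (fun i j => i = j ∨ i / 2 < j / 2)
    (fun i j => j = levelMatch n i ∧ i ≤ 2 * ((n - 1) / 2) + 1 ∨ j = 2 * n ∧ i ≤ 2 * (n / 2) + 1)
    (fun p q => P5.le_iff) (fun p q => mem_S5) (2 * (n / 2) + 1) (2 * n) (2 * n) (2 * n + 1)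
    (fun i j => by lia) (fun i j => by unfold levelMatch; lia) (by lia) (fun i => by lia) ?_
    (fun j => by lia) (by lia) (by lia) (fun j => by lia) (fun j => by lia) (fun i => by lia)
    (by lia) (by unfold levelMatch; lia) (card_S5_add_one_le hn) (hasScalarKernel_S5 k hn)
  intro j h1 h2
  by_cases h : j = 2 * n
  · exact ⟨1, by lia⟩
  · exact ⟨levelMatch n j, by unfold levelMatch; lia⟩

end P5

/-! ### The dual posets and the order-reversing bijections. -/

section Duals

/-- A bijection of `{1, …, m}` given by two functions on the natural numbers. -/
def labelEquiv {m : ℕ} (f g : ℕ → ℕ)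
    (hf : ∀ i, 1 ≤ i → i ≤ m → (1 ≤ f i ∧ f i ≤ m) ∧ g (f i) = i)
    (hg : ∀ i, 1 ≤ i → i ≤ m → (1 ≤ g i ∧ g i ≤ m) ∧ f (g i) = i) : Label m ≃ Label m where
  toFun p := ⟨f p.1, (hf p.1 p.2.1 p.2.2).1⟩
  invFun p := ⟨g p.1, (hg p.1 p.2.1 p.2.2).1⟩
  left_inv p := Subtype.ext (hf p.1 p.2.1 p.2.2).2
  right_inv p := Subtype.ext (hg p.1 p.2.1 p.2.2).2

theorem P3Star.le_iff {p q : P3Star} :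
    p ≤ q ↔ p.1 = q.1 ∨ (p.1 < q.1 ∧ (5 ≤ q.1 ∨ q.1 = p.1 + 2)) := Iff.rfl

theorem mem_S3Star {p q : P3Star} : (p, q) ∈ S3Star ↔ p.1 = 1 ∧ q.1 = 6 ∨ p.1 = 2 ∧ q.1 = 6 ∨
    p.1 = 3 ∧ q.1 = 5 ∨ p.1 = 4 ∧ q.1 = 5 ∨ p.1 = 2 ∧ q.1 = 5 := by
  refine mem_pairsOf.trans ?_
  simp

/-- The order-reversing bijection of `P3` with its dual. -/
def P3.dualEquiv : P3 ≃ P3Star :=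
  labelEquiv (m := 6)
    (fun i => if i = 1 then 6 else if i = 2 then 5 else if 5 ≤ i then i - 4 else i)
    (fun i => if i = 6 then 1 else if i = 5 then 2 else if i ≤ 2 then i + 4 else i)
    (fun i h1 h2 => by split_ifs <;> lia) (fun i h1 h2 => by split_ifs <;> lia)

theorem P3.dualEquiv_coe (p : P3) : (P3.dualEquiv p).1 =
    if p.1 = 1 then 6 else if p.1 = 2 then 5 else if 5 ≤ p.1 then p.1 - 4 else p.1 := rfl

theorem isCombinatorialToralPair_S3Star (k : Type*) [Field k] :
    IsCombinatorialToralPair k S3Star := by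
  refine (isCombinatorialToralPair_S3 k).dual P3.dualEquiv (fun p q => ?_) (fun p q => ?_)
  · have := p.2
    have := q.2
    rw [P3.le_iff, P3Star.le_iff, P3.dualEquiv_coe, P3.dualEquiv_coe]
    split_ifs <;> lia
  · have := p.2
    have := q.2
    rw [mem_S3, mem_S3Star, P3.dualEquiv_coe, P3.dualEquiv_coe]
    split_ifs <;> lia

variable {n : ℕ}

theorem P4Star.le_iff {p q : P4Star n} :
    p ≤ q ↔ p.1 = q.1 ∨ (p.1 < q.1 ∧ q.1 ≠ (n - 1) / 2 + 1) := Iff.rfl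

theorem mem_S4Star {p q : P4Star n} : (p, q) ∈ S4Star n ↔
    p.1 + q.1 = n + 1 ∧ p.1 ≤ (n - 1) / 2 ∨ p.1 = (n + 1) / 2 ∧ (n + 1) / 2 < q.1 := by
  refine mem_pairsOf.trans ?_
  have hp := p.2
  have hq := q.2
  simp only [Finset.mem_union, Finset.mem_image, Finset.mem_Icc, Prod.mk.injEq]
  constructor
  · rintro (⟨a, h⟩ | ⟨a, h⟩) <;> lia
  · rintro (h | h)
    · exact Or.inl ⟨p.1, by lia⟩
    · exact Or.inr ⟨q.1, by lia⟩

/-- The order-reversing bijection of `P4 n` with its dual. -/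
def P4.dualEquiv (n : ℕ) : P4 n ≃ P4Star n :=
  labelEquiv (m := n)
    -- The hub goes to `⌈n/2⌉`, the common source of the hub edges of `S4Star`; the sources are
    -- reversed onto the labels above it, the other sinks onto those below.
    (fun i => if i = n then (n + 1) / 2 else if i ≤ n / 2 then n + 1 - i else n - i)
    (fun i => if i = (n + 1) / 2 then n else if (n + 1) / 2 < i then n + 1 - i else n - i)
    (fun i h1 h2 => by split_ifs <;> lia) (fun i h1 h2 => by split_ifs <;> lia)

theorem P4.dualEquiv_coe (p : P4 n) : (P4.dualEquiv n p).1 =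
    if p.1 = n then (n + 1) / 2 else if p.1 ≤ n / 2 then n + 1 - p.1 else n - p.1 := rfl

theorem isCombinatorialToralPair_S4Star (k : Type*) [Field k] (hn : 2 ≤ n) :
    IsCombinatorialToralPair k (S4Star n) := by
  refine (isCombinatorialToralPair_S4 k hn).dual (P4.dualEquiv n) (fun p q => ?_) (fun p q => ?_)
  · have := p.2
    have := q.2
    rw [P4.le_iff, P4Star.le_iff, P4.dualEquiv_coe, P4.dualEquiv_coe]
    split_ifs <;> lia
  · have := p.2
    have := q.2
    rw [mem_S4, mem_S4Star, P4.dualEquiv_coe, P4.dualEquiv_coe]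
    split_ifs <;> lia

/-- The levels are now `{1, 2}, {3, 4}, …, {2n + 1}`, whence the shift to `(i + 1) / 2`. -/
theorem P5Star.le_iff {p q : P5Star n} : p ≤ q ↔ p.1 = q.1 ∨ (p.1 + 1) / 2 < (q.1 + 1) / 2 := by
  have h : p ≤ q ↔ p.1 = q.1 ∨ (p.1 % 2 = 1 ∧ p.1 + 2 ≤ q.1) ∨ (p.1 % 2 = 0 ∧ p.1 + 1 ≤ q.1) :=
    Iff.rfl
  rw [h]
  lia

theorem mem_S5Star {p q : P5Star n} : (p, q) ∈ S5Star n ↔ p.1 = 1 ∧ q.1 = 2 * n + 1 ∨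
    p.1 = 2 ∧ 2 * ((n + 1) / 2) + 1 ≤ q.1 ∨
    (p.1 % 2 = 0 ∧ 4 ≤ p.1 ∧ p.1 ≤ 2 * ((n + 1) / 2) ∧ p.1 + q.1 = 2 * n + 4) ∨
    (p.1 % 2 = 1 ∧ 3 ≤ p.1 ∧ p.1 ≤ 2 * ((n - 1) / 2) + 1 ∧ p.1 + q.1 = 2 * n + 2) := by
  refine mem_pairsOf.trans ?_
  have hp := p.2
  have hq := q.2
  simp only [Finset.mem_union, Finset.mem_image, Finset.mem_Icc, Prod.mk.injEq,
    Finset.mem_singleton]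
  constructor
  · rintro (((h | ⟨a, h⟩) | ⟨a, h⟩) | ⟨a, h⟩) <;> lia
  · rintro (h | h | h | h)
    · exact Or.inl (Or.inl (Or.inl h))
    · exact Or.inl (Or.inl (Or.inr ⟨q.1, by lia⟩))
    · exact Or.inl (Or.inr ⟨p.1 / 2, by lia⟩)
    · exact Or.inr ⟨p.1 / 2, by lia⟩

/-- The order-reversing bijection of `P5 n` with its dual. -/
def P5.dualEquiv (n : ℕ) : P5 n ≃ P5Star n :=
  labelEquiv (m := 2 * n + 1) (fun i => 2 * n + 2 - i) (fun i => 2 * n + 2 - i)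
    (fun i h1 h2 => by lia) (fun i h1 h2 => by lia)

theorem P5.dualEquiv_coe (p : P5 n) : (P5.dualEquiv n p).1 = 2 * n + 2 - p.1 := rfl

theorem isCombinatorialToralPair_S5Star (k : Type*) [Field k] (hn : 1 ≤ n) :
    IsCombinatorialToralPair k (S5Star n) := by
  refine (isCombinatorialToralPair_S5 k hn).dual (P5.dualEquiv n) (fun p q => ?_) (fun p q => ?_)
  · have := p.2
    have := q.2
    rw [P5.le_iff, P5Star.le_iff, P5.dualEquiv_coe, P5.dualEquiv_coe]
    lia
  · have := p.2
    have := q.2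
    rw [mem_S5, mem_S5Star, P5.dualEquiv_coe, P5.dualEquiv_coe]
    unfold levelMatch
    lia

end Duals

theorem mainTheorem6 (k : Type*) [Field k] [CharZero k] :
    IsToralPair k S3 ∧
    IsToralPair k S3Star ∧
    (∀ n : ℕ, 2 ≤ n → IsToralPair k (S4 n)) ∧
    (∀ n : ℕ, 2 ≤ n → IsToralPair k (S4Star n)) ∧
    (∀ n : ℕ, 1 ≤ n → IsToralPair k (S5 n)) ∧
    (∀ n : ℕ, 1 ≤ n → IsToralPair k (S5Star n)) :=
  ⟨(isCombinatorialToralPair_S3 k).isToralPair,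
    (isCombinatorialToralPair_S3Star k).isToralPair,
    fun _ hn => (isCombinatorialToralPair_S4 k hn).isToralPair,
    fun _ hn => (isCombinatorialToralPair_S4Star k hn).isToralPair,
    fun _ hn => (isCombinatorialToralPair_S5 k hn).isToralPair,
    fun _ hn => (isCombinatorialToralPair_S5Star k hn).isToralPair⟩
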